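/- Let $N\ge 2$, let $D=[x_0,x_N]\times[y_0,y_N]$ be a square with $x_N-x_0=y_N-y_0>0$, and let $x_i=x_0+\frac{i}{N}(x_N-x_0)$, $y_j=y_0+\frac{j}{N}(y_N-y_0)$ for $0\le i,j\le N$. For $1\le i\le N$ let $u_i$ be the affine map of $[x_0,x_N]$ onto $[x_{i-1},x_i]$ that is increasing if $i$ is odd and decreasing if $i$ is even, and for $1\le j\le N$ let $v_j$ be the affine map of $[y_0,y_N]$ onto $[y_{j-1},y_j]$ that is increasing if $j$ is odd and decreasing if $j$ is even. Put $\Sigma=\{1,\dots,N\}^2$ and, for $w=(i,j)\in\Sigma$, $L_w(x,y)=(u_i(x),v_j(y))$. For a word $\mathbf w=w_1\cdots w_n\in\Sigma^n$ let $L_{\mathbf w}=L_{w_1}\circ\cdots\circ L_{w_n}$ and $D_{\mathbf w}=L_{\mathbf w}(D)$. Let $z_{ij}\in\mathbb R$ $(0\le i,j\le N)$, and let $g,h,S:D\to\mathbb R$ be continuous with $g(x_i,y_j)=z_{ij}$ for $i,j\in\{0,N\}$, $h(x_i,y_j)=z_{ij}$ for all $0\le i,j\le N$, and $|S|<1$ on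 $D$. Let $f:D\to\mathbb R$ be the generalized affine fractal interpolation function of these data, that is, the continuous function with $f(x_i,y_j)=z_{ij}$ for all $0\le i,j\le N$ whose graph $\Gamma f=\{(x,y,f(x,y)):(x,y)\in D\}$ satisfies $\Gamma f=\bigcup_{w\in\Sigma}\Psi_w(\Gamma f)$, where $$\Psi_w(x,y,z)=\bigl(L_w(x,y),\;S(L_w(x,y))\,(z-g(x,y))+h(L_w(x,y))\bigr).$$ Assume that $S$ is Lipschitz on $D$, and that the function $q$ on $D$ given by $q(t)=h(t)-S(t)\,g(L_w^{-1}(t))$ for $t\in D_w$, $w\in\Sigma$, is Lipschitz on $D$. For $p\ge 1$ let $O_p(f,D)=\sum_{\mathbf w\in\Sigma^p}\sup\{f(a)-f(b):a,b\in D_{\mathbf w}\}$. For $n\ge 1$ let $\overline M_n$ be the $\Sigma^n\times\Sigma^n$ matrix whose entry at $(\mathbf i,\mathbf j)$ is $\sup_{D_{\mathbf i j_n}}|S|$ if $i_2\cdots i_n=j_1\cdots j_{n-1}$, and $0$ otherwise; let $\underline M_n$ be defined in the same way with $\inf$ in place of $\sup$. Write $\rho(A)$ for the spectral radius of a matrix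 $A$. **Theorem.** Suppose that $S>0$ everywhere on $D$ or $S<0$ everywhere on $D$. Then $\rho(\overline M_n)$ and $\rho(\underline M_n)$ converge, as $n\to\infty$, to a common limit $\rho_S$. If $\rho_S>N$ and $\limsup_{p\to\infty}O_p(f,D)/N^p=+\infty$, then the box dimension of $\Gamma f$ exists and $$\dim_B\Gamma f=1+\frac{\log\rho_S}{\log N}.$$ Otherwise, the box dimension of $\Gamma f$ exists and $\dim_B\Gamma f=2$. -/

import Mathlib

open Filter Topology

noncomputable section

/-! ### Box dimension in `ℝ^d` -/

/-- The closed `ε`-coordinate cube `∏ [n_i ε, (n_i + 1) ε]`. -/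
def coordCube {d : ℕ} (ε : ℝ) (n : Fin d → ℤ) : Set (Fin d → ℝ) :=
  {p | ∀ i, (n i : ℝ) * ε ≤ p i ∧ p i ≤ ((n i : ℝ) + 1) * ε}

/-- The number of `ε`-coordinate cubes that meet `E` (a finite number when `E` is bounded
and `ε > 0`). -/
def cubeCount {d : ℕ} (E : Set (Fin d → ℝ)) (ε : ℝ) : ℕ :=
  Set.ncard {n : Fin d → ℤ | (coordCube ε n ∩ E).Nonempty}

/-- Upper box dimension of a bounded set. -/
def upperBoxDim {d : ℕ} (E : Set (Fin d → ℝ)) : EReal :=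
  limsup (fun ε : ℝ => ((Real.log (cubeCount E ε) / Real.log (1 / ε) : ℝ) : EReal)) (𝓝[>] 0)

/-- Lower box dimension of a bounded set. -/
def lowerBoxDim {d : ℕ} (E : Set (Fin d → ℝ)) : EReal :=
  liminf (fun ε : ℝ => ((Real.log (cubeCount E ε) / Real.log (1 / ε) : ℝ) : EReal)) (𝓝[>] 0)

/-- The box dimension of `E` exists and equals `s`. -/
def HasBoxDim {d : ℕ} (E : Set (Fin d → ℝ)) (s : ℝ) : Prop :=
  lowerBoxDim E = (s : EReal) ∧ upperBoxDim E = (s : EReal)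

/-! ### Oscillation and spectral radius -/

/-- Oscillation `sup {φ a - φ b : a, b ∈ E}`. -/
def osc (φ : ℝ × ℝ → ℝ) (E : Set (ℝ × ℝ)) : ℝ :=
  sSup {r | ∃ a ∈ E, ∃ b ∈ E, r = φ a - φ b}

/-- Spectral radius of a real square matrix: the largest modulus of its complex eigenvalues. -/
def specRad {ι : Type} [Fintype ι] [DecidableEq ι] (A : Matrix ι ι ℝ) : ℝ :=
  (spectralRadius ℂ (A.map (fun a : ℝ => (a : ℂ)))).toReal

/-! ### Generalized affine fractal interpolation surfaces -/

/-- The rectangle `[x_0, x_N] × [y_0, y_N]`. -/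
def gridDomain {N : ℕ} (x y : Fin (N + 1) → ℝ) : Set (ℝ × ℝ) :=
  Set.Icc (x 0) (x (Fin.last N)) ×ˢ Set.Icc (y 0) (y (Fin.last N))

/-- The affine map of `[x_0, x_N]` onto the `i`-th subinterval, with alternating orientation.
The index is zero-based: `i : Fin N` stands for the subinterval `[x_i, x_{i+1}]`, and the map
preserves the orientation exactly when `i` is even (that is, when `i + 1` is odd). -/
def foldMap {N : ℕ} (x : Fin (N + 1) → ℝ) (i : Fin N) (t : ℝ) : ℝ :=
  if Even (i : ℕ) then
    x i.castSucc + (t - x 0) / (x (Fin.last N) - x 0) * (x i.succ - x i.castSucc)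
  else
    x i.succ + (t - x 0) / (x (Fin.last N) - x 0) * (x i.castSucc - x i.succ)

/-- The data of a generalized affine fractal interpolation surface over an `N × N` grid. -/
structure FISData (N : ℕ) where
  x : Fin (N + 1) → ℝ
  y : Fin (N + 1) → ℝ
  z : Fin (N + 1) → Fin (N + 1) → ℝ
  g : ℝ × ℝ → ℝ
  h : ℝ × ℝ → ℝ
  S : ℝ × ℝ → ℝ
  x_strictMono : StrictMono x
  y_strictMono : StrictMono y
  g_continuousOn : ContinuousOn g (gridDomain x y)
  h_continuousOn : ContinuousOn h (gridDomain x y)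
  S_continuousOn : ContinuousOn S (gridDomain x y)
  g_corner : ∀ i j : Fin (N + 1), (i = 0 ∨ i = Fin.last N) → (j = 0 ∨ j = Fin.last N) →
    g (x i, y j) = z i j
  h_node : ∀ i j : Fin (N + 1), h (x i, y j) = z i j
  abs_S_lt_one : ∀ t ∈ gridDomain x y, |S t| < 1

namespace FISData

variable {N : ℕ} (P : FISData N)

/-- The domain `D`. -/
def D : Set (ℝ × ℝ) := gridDomain P.x P.y

/-- The domain is a square and both families of nodes are equally spaced. -/
def IsUniform : Prop :=
  P.x (Fin.last N) - P.x 0 = P.y (Fin.last N) - P.y 0 ∧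
  (∀ i : Fin N, P.x i.succ - P.x i.castSucc = (P.x (Fin.last N) - P.x 0) / N) ∧
  (∀ j : Fin N, P.y j.succ - P.y j.castSucc = (P.y (Fin.last N) - P.y 0) / N)

/-- The map `L_w : D → D_w`. -/
def L (w : Fin N × Fin N) (t : ℝ × ℝ) : ℝ × ℝ := (foldMap P.x w.1 t.1, foldMap P.y w.2 t.2)

/-- `F_w(t, z) = S(L_w t) (z - g t) + h(L_w t)`. -/
def F (w : Fin N × Fin N) (t : ℝ × ℝ) (z : ℝ) : ℝ :=
  P.S (P.L w t) * (z - P.g t) + P.h (P.L w t)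

/-- `Ψ_w(x, y, z) = (L_w(x, y), F_w(x, y, z))`. -/
def Psi (w : Fin N × Fin N) (p : Fin 3 → ℝ) : Fin 3 → ℝ :=
  ![(P.L w (p 0, p 1)).1, (P.L w (p 0, p 1)).2, P.F w (p 0, p 1) (p 2)]

/-- The graph of `f` over `D`, as a subset of `ℝ³`. -/
def graph (f : ℝ × ℝ → ℝ) : Set (Fin 3 → ℝ) :=
  (fun t : ℝ × ℝ => ![t.1, t.2, f t]) '' P.D

/-- `f` is (on `D`) the generalized affine fractal interpolation function of the data: it is
continuous, interpolates the data, and its graph is invariant under the iterated function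
system `(Ψ_w)`. -/
structure IsFIF (f : ℝ × ℝ → ℝ) : Prop where
  continuousOn : ContinuousOn f P.D
  interpolates : ∀ i j : Fin (N + 1), f (P.x i, P.y j) = P.z i j
  invariant : P.graph f = ⋃ w : Fin N × Fin N, P.Psi w '' P.graph f

/-- `q` is the function with `q(t) = h(t) - S(t) g(L_w⁻¹ t)` for `t ∈ D_w = L_w(D)`, `w ∈ Σ`;
this determines `q` on `D`. -/
def IsOffset (q : ℝ × ℝ → ℝ) : Prop :=
  ∀ w : Fin N × Fin N, ∀ t ∈ P.D, q (P.L w t) = P.h (P.L w t) - P.S (P.L w t) * P.g t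

/-- `L_w = L_{w_1} ∘ ⋯ ∘ L_{w_n}` for a word `w` of length `n`. -/
def wordMap : (n : ℕ) → (Fin n → Fin N × Fin N) → ℝ × ℝ → ℝ × ℝ
  | 0, _ => id
  | n + 1, w => P.L (w 0) ∘ wordMap n (Fin.tail w)

/-- The cell `D_w = L_w(D)` of a word `w`. -/
def cell {n : ℕ} (w : Fin n → Fin N × Fin N) : Set (ℝ × ℝ) := P.wordMap n w '' P.D

/-- The oscillation sum `O_n(φ, D)` of level `n`. -/
def oscSum (φ : ℝ × ℝ → ℝ) (n : ℕ) : ℝ :=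
  ∑ w : Fin n → Fin N × Fin N, osc φ (P.cell w)

/-- `sup |S|` over the cell of `w`. -/
def upS {n : ℕ} (w : Fin n → Fin N × Fin N) : ℝ := sSup ((fun t => |P.S t|) '' P.cell w)

/-- `inf |S|` over the cell of `w`. -/
def lowS {n : ℕ} (w : Fin n → Fin N × Fin N) : ℝ := sInf ((fun t => |P.S t|) '' P.cell w)

/-- The upper vertical scaling matrix of level `n + 1`: for words `i, j` of length `n + 1`, the
entry is `sup |S|` over the cell of `i j_{n+1}` if `i_2 ⋯ i_{n+1} = j_1 ⋯ j_n`, and `0` otherwise. -/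
def upM (n : ℕ) : Matrix (Fin (n + 1) → Fin N × Fin N) (Fin (n + 1) → Fin N × Fin N) ℝ :=
  fun i j => if Fin.tail i = Fin.init j then
    P.upS (Fin.snoc i (j (Fin.last n)) : Fin (n + 2) → Fin N × Fin N) else 0

/-- The lower vertical scaling matrix of level `n + 1`, with `inf |S|` in place of `sup |S|`. -/
def lowM (n : ℕ) : Matrix (Fin (n + 1) → Fin N × Fin N) (Fin (n + 1) → Fin N × Fin N) ℝ :=
  fun i j => if Fin.tail i = Fin.init j then
    P.lowS (Fin.snoc i (j (Fin.last n)) : Fin (n + 2) → Fin N × Fin N) else 0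

end FISData

end

/-! ### Spectral radii of nonnegative matrices -/

section SpectralRadius

attribute [local instance] Matrix.linftyOpNormedRing Matrix.linftyOpNormedAlgebra

/-! Invariance of the graph means f(L_l t) = S(L_l t) f(t) + q(L_l t). Since S and q are Lipschitz
and f is bounded, passing from the cell of a word w of length p to the cell of lw multiplies the
oscillation by |S(L_l t)|, for any t in the cell of w, up to an error O(N^-p)
(`exists_osc_cell_cons`). The oscillation sums O_p are therefore governed by the transfer operator
Tφ(t) = Σ_l |S(L_l t)| φ(L_l t).

S does not vanish on D, so log |S| is Lipschitz. As the L_l contract by 1/N ≤ 1/2, the function T^p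
1 varies over D by a factor bounded independently of p (`transfer_le_exp`). Hence T^p 1 is
multiplicative in p up to constants, and a two-sided Fekete argument (`exists_pow_comparable`) gives
T^p 1 ≍ r^p uniformly on D. This r is ρ_S: the column sums of the m-th powers of the lower and upper
matrices enclose T^m 1, and the two matrices differ entrywise by a factor tending to 1, so Gelfand's
formula pinches both spectral radii to r, without Perron–Frobenius theory.

With t_w the image of a corner of D under L_w, the sums E(p, j) = Σ_w T^j 1(t_w) osc(f, D_w) satisfy
|E(p+1, j) - E(p, j+1)| ≤ C' N^p r^j. Chaining these relations links O_{p+k} = E(p+k, 0) to E(p, k)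
≍ r^k O_p. Starting from p = 0, this yields O_k ≤ A s^k whenever s ≥ r and s > N. If r > N, the
total error is at most a constant times r^k N^p, so a single level p at which O_p / N^p is large
enough forces O_m ≥ A r^m for all m ≥ p; the limsup condition supplies that level.

Finally, for ε ≍ N^-p the number of ε-cubes meeting the graph is comparable to O_p / ε + N^(2p). The
first term produces 1 + log r / log N when O_p ≍ r^p with r > N. In the other cases O_p is at most a
constant times N^((1+η)p) for every η > 0, and the second term produces 2. -/

theorem tendsto_norm_pow_specRad {ι : Type} [Fintype ι] [DecidableEq ι] (A : Matrix ι ι ℝ) :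
    Tendsto (fun m : ℕ => ‖(A.map (fun a : ℝ => (a : ℂ))) ^ m‖ ^ (1 / m : ℝ)) atTop
      (𝓝 (specRad A)) := by
  set B : Matrix ι ι ℂ := A.map (fun a : ℝ => (a : ℂ)) with hB
  have h := spectrum.pow_norm_pow_one_div_tendsto_nhds_spectralRadius B
  have hfin : spectralRadius ℂ B ≠ ⊤ := by
    rcases isEmpty_or_nonempty ι with hι | hι
    · have : Subsingleton (Matrix ι ι ℂ) := inferInstance
      simp [spectralRadius, spectrum.of_subsingleton]
    · exact ((spectrum.spectralRadius_le_nnnorm (𝕜 := ℂ) B).trans_lt ENNReal.coe_lt_top).ne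
  have h2 := (ENNReal.tendsto_toReal hfin).comp h
  refine h2.congr fun m => ?_
  simp only [Function.comp]
  rw [ENNReal.toReal_ofReal (by positivity)]

theorem map_ofReal_pow {ι : Type} [Fintype ι] [DecidableEq ι] (A : Matrix ι ι ℝ) (m : ℕ) :
    (A.map (fun a : ℝ => (a : ℂ))) ^ m = (A ^ m).map (fun a : ℝ => (a : ℂ)) := by
  have := map_pow (Complex.ofRealHom.mapMatrix (m := ι)) A m
  exact this.symm

theorem matrix_pow_nonneg {ι : Type} [Fintype ι] [DecidableEq ι] {A : Matrix ι ι ℝ}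
    (hA : ∀ i j, 0 ≤ A i j) (m : ℕ) : ∀ i j, 0 ≤ (A ^ m) i j := by
  induction m with
  | zero => intro i j; rw [pow_zero, Matrix.one_apply]; split_ifs <;> norm_num
  | succ m ih =>
    intro i j
    rw [pow_succ, Matrix.mul_apply]
    exact Finset.sum_nonneg fun k _ => mul_nonneg (ih i k) (hA k j)

theorem norm_map_ofReal_le_sum {ι : Type} [Fintype ι] [DecidableEq ι] {A : Matrix ι ι ℝ}
    (hA : ∀ i j, 0 ≤ A i j) : ‖A.map (fun a : ℝ => (a : ℂ))‖ ≤ ∑ i, ∑ j, A i j := by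
  have hs : ∀ i, 0 ≤ ∑ j, A i j := fun i => Finset.sum_nonneg fun j _ => hA i j
  have : ‖A.map (fun a : ℝ => (a : ℂ))‖₊ ≤ (∑ i, ∑ j, A i j).toNNReal := by
    rw [Matrix.linfty_opNNNorm_def]
    refine Finset.sup_le fun i _ => ?_
    rw [← NNReal.coe_le_coe, Real.coe_toNNReal _ (Finset.sum_nonneg fun i _ => hs i)]
    push_cast
    refine le_trans (le_of_eq ?_)
      (Finset.single_le_sum (f := fun i => ∑ j, A i j) (fun i _ => hs i) (Finset.mem_univ i))
    exact Finset.sum_congr rfl fun j _ => by simp [abs_of_nonneg (hA i j)]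
  have h2 := NNReal.coe_le_coe.2 this
  rwa [Real.coe_toNNReal _ (Finset.sum_nonneg fun i _ => hs i), coe_nnnorm] at h2

theorem sum_le_card_mul_norm_map_ofReal {ι : Type} [Fintype ι] [DecidableEq ι]
    {A : Matrix ι ι ℝ} (hA : ∀ i j, 0 ≤ A i j) :
    ∑ i, ∑ j, A i j ≤ Fintype.card ι * ‖A.map (fun a : ℝ => (a : ℂ))‖ := by
  have h : ∀ i, ∑ j, A i j ≤ ‖A.map (fun a : ℝ => (a : ℂ))‖ := by
    intro i
    have : ∑ j, ‖A.map (fun a : ℝ => (a : ℂ)) i j‖₊ ≤ ‖A.map (fun a : ℝ => (a : ℂ))‖₊ := by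
      rw [Matrix.linfty_opNNNorm_def]
      exact Finset.le_sup (f := fun i => ∑ j, ‖A.map (fun a : ℝ => (a : ℂ)) i j‖₊)
        (Finset.mem_univ i)
    have h2 := NNReal.coe_le_coe.2 this
    push_cast at h2
    refine le_trans (le_of_eq ?_) h2
    exact Finset.sum_congr rfl fun j _ => by simp [abs_of_nonneg (hA i j)]
  calc ∑ i, ∑ j, A i j ≤ ∑ _i : ι, ‖A.map (fun a : ℝ => (a : ℂ))‖ :=
        Finset.sum_le_sum fun i _ => h i
    _ = _ := by simp

theorem tendsto_mul_pow_rpow_one_div {c r : ℝ} (hc : 0 < c) (hr : 0 ≤ r) :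
    Tendsto (fun m : ℕ => (c * r ^ m) ^ (1 / m : ℝ)) atTop (𝓝 r) := by
  have h1 : Tendsto (fun m : ℕ => c ^ (1 / m : ℝ) * r) atTop (𝓝 (c ^ (0 : ℝ) * r)) := by
    refine Tendsto.mul_const _ ?_
    exact (Real.continuous_const_rpow hc.ne').continuousAt.tendsto.comp
      tendsto_one_div_atTop_nhds_zero_nat
  rw [Real.rpow_zero, one_mul] at h1
  refine h1.congr' ?_
  filter_upwards [eventually_gt_atTop 0] with m hm
  rw [Real.mul_rpow hc.le (by positivity), ← Real.rpow_natCast, ← Real.rpow_mul hr,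
    mul_one_div_cancel (by positivity), Real.rpow_one]

/-- Gelfand's formula: on nonnegative matrices the norm (largest row sum) and the sum of all entries
agree up to the factor `card ι`, which disappears under m-th roots. -/
theorem specRad_le_of_sum_pow_le {ι : Type} [Fintype ι] [DecidableEq ι] {A : Matrix ι ι ℝ}
    (hA : ∀ i j, 0 ≤ A i j) {C r : ℝ} (hC : 0 < C) (hr : 0 ≤ r)
    (h : ∀ m : ℕ, ∑ i, ∑ j, (A ^ m) i j ≤ C * r ^ m) : specRad A ≤ r := by
  refine le_of_tendsto_of_tendsto (tendsto_norm_pow_specRad A)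
    (tendsto_mul_pow_rpow_one_div hC hr) (Eventually.of_forall fun m => ?_)
  refine Real.rpow_le_rpow (norm_nonneg _) ?_ (by positivity)
  rw [map_ofReal_pow]
  exact (norm_map_ofReal_le_sum (matrix_pow_nonneg hA m)).trans (h m)

theorem le_specRad_of_le_sum_pow {ι : Type} [Fintype ι] [DecidableEq ι] [Nonempty ι]
    {A : Matrix ι ι ℝ} (hA : ∀ i j, 0 ≤ A i j) {c r : ℝ} (hc : 0 < c) (hr : 0 ≤ r)
    (h : ∀ m : ℕ, c * r ^ m ≤ ∑ i, ∑ j, (A ^ m) i j) : r ≤ specRad A := by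
  have hcard : (0 : ℝ) < Fintype.card ι := by exact_mod_cast Fintype.card_pos
  refine le_of_tendsto_of_tendsto
    (tendsto_mul_pow_rpow_one_div (c := c / Fintype.card ι) (by positivity) hr)
    (tendsto_norm_pow_specRad A) (Eventually.of_forall fun m => ?_)
  refine Real.rpow_le_rpow (by positivity) ?_ (by positivity)
  rw [map_ofReal_pow, div_mul_eq_mul_div, div_le_iff₀' hcard]
  exact (h m).trans (sum_le_card_mul_norm_map_ofReal (matrix_pow_nonneg hA m))

end SpectralRadius

theorem matrix_pow_le_pow_mul {ι : Type} [Fintype ι] [DecidableEq ι] {A B : Matrix ι ι ℝ} {c : ℝ}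
    (hA : ∀ i j, 0 ≤ A i j) (hAB : ∀ i j, A i j ≤ c * B i j) (m : ℕ) :
    ∀ i j, (A ^ m) i j ≤ c ^ m * (B ^ m) i j := by
  induction m with
  | zero => intro i j; simp
  | succ m ih =>
    intro i j
    rw [pow_succ, pow_succ B, Matrix.mul_apply, Matrix.mul_apply, Finset.mul_sum]
    refine Finset.sum_le_sum fun k _ => ?_
    have := mul_le_mul (ih i k) (hAB k j) (hA k j)
      ((matrix_pow_nonneg hA m i k).trans (ih i k))
    refine this.trans (le_of_eq (by ring))

/-! ### Almost multiplicative sequences -/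

/-- Both log C + log b and log C - log b are subadditive, and their sum is constant, so their Fekete
limits are opposite. Each limit is an infimum of quotients, which makes the bounds valid at every p
and not only asymptotically. -/
theorem exists_pow_comparable {b : ℕ → ℝ} {C : ℝ} (hC : 1 ≤ C) (hb : ∀ p, 0 < b p)
    (hle : ∀ p q, b (p + q) ≤ C * (b p * b q)) (hge : ∀ p q, b p * b q ≤ C * b (p + q)) :
    ∃ r : ℝ, 0 < r ∧ ∀ p, r ^ p ≤ C * b p ∧ b p ≤ C * r ^ p := by
  have hC0 : 0 < C := by linarith
  set u : ℕ → ℝ := fun p => Real.log C + Real.log (b p) with hu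
  set v : ℕ → ℝ := fun p => Real.log C - Real.log (b p) with hv
  have hlogC : 0 ≤ Real.log C := Real.log_nonneg hC
  have hsu : Subadditive u := by
    intro p q
    have := Real.log_le_log (hb _) (hle p q)
    rw [Real.log_mul hC0.ne' (mul_pos (hb p) (hb q)).ne',
      Real.log_mul (hb p).ne' (hb q).ne'] at this
    simp only [hu]; linarith
  have hsv : Subadditive v := by
    intro p q
    have := Real.log_le_log (mul_pos (hb p) (hb q)) (hge p q)
    rw [Real.log_mul hC0.ne' (hb _).ne', Real.log_mul (hb p).ne' (hb q).ne'] at this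
    simp only [hv]; linarith
  have hlin : ∀ w : ℕ → ℝ, Subadditive w → ∀ p : ℕ, w (p + 1) ≤ (p + 1) * w 1 := by
    intro w hw p
    induction p with
    | zero => simp
    | succ p ih => have := hw (p + 1) 1; push_cast; linarith
  have hbdd : ∀ w w' : ℕ → ℝ, Subadditive w' → (∀ p, 0 ≤ w p + w' p) →
      BddBelow (Set.range fun n : ℕ => w n / n) := by
    intro w w' hw' hww
    -- For n > 0, w n ≥ -w' n ≥ -n w' 1; the 0 covers the quotient at n = 0, which is 0 by
    -- convention.
    refine ⟨min 0 (-w' 1), ?_⟩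
    rintro _ ⟨n, rfl⟩
    rcases n with _ | n
    · simp
    · refine (min_le_right _ _).trans ?_
      simp only
      rw [le_div_iff₀ (by positivity)]
      have := hlin w' hw' n
      have := hww (n + 1)
      push_cast; linarith
  have huv : ∀ p, u p + v p = 2 * Real.log C := fun p => by simp only [hu, hv]; ring
  have bu := hbdd u v hsv fun p => by rw [huv]; linarith
  have bv := hbdd v u hsu fun p => by rw [add_comm, huv]; linarith
  have hsum : hsu.lim + hsv.lim = 0 := by
    have h1 := (hsu.tendsto_lim bu).add (hsv.tendsto_lim bv)
    have h2 : Tendsto (fun n : ℕ => 2 * Real.log C / n) atTop (𝓝 0) :=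
      tendsto_const_div_atTop_nhds_zero_nat _
    refine tendsto_nhds_unique h1 (h2.congr fun n => ?_)
    rw [← add_div, huv]
  refine ⟨Real.exp hsu.lim, Real.exp_pos _, fun p => ?_⟩
  -- Fekete's infimum excludes p = 0; there the two hypotheses at (0, 0) give 1 ≤ C b 0 and b 0 ≤ C.
  rcases p with _ | p
  · have h1 := hle 0 0
    have h2 := hge 0 0
    simp only [add_zero, pow_zero, mul_one] at *
    have h0 := hb 0
    constructor
    · by_contra! h; nlinarith
    · by_contra! h; nlinarith
  · rw [← Real.exp_nat_mul]
    have h1 := hsu.lim_le_div bu (n := p + 1) (by omega)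
    have h2 := hsv.lim_le_div bv (n := p + 1) (by omega)
    rw [le_div_iff₀ (by positivity)] at h1 h2
    have e1 : Real.exp (u (p + 1)) = C * b (p + 1) := by
      simp only [hu]; rw [Real.exp_add, Real.exp_log hC0, Real.exp_log (hb _)]
    constructor
    · rw [← e1]; exact Real.exp_le_exp.2 (by linarith)
    · rw [← Real.exp_log (hb (p + 1)), ← Real.exp_log hC0, ← Real.exp_add, Real.exp_le_exp]
      simp only [hv] at h2
      have : hsv.lim = -hsu.lim := by linarith
      rw [this] at h2
      linarith

/-! ### Folding maps on a uniform grid -/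

theorem node_eq_of_uniform {N : ℕ} {x : Fin (N + 1) → ℝ} {d : ℝ}
    (h : ∀ i : Fin N, x i.succ - x i.castSucc = d) (i : Fin (N + 1)) : x i = x 0 + i * d := by
  induction i using Fin.induction with
  | zero => simp
  | succ i ih =>
    have := h i
    simp only [Fin.val_succ, Fin.val_castSucc] at ih ⊢
    push_cast
    linarith

section FoldMap

variable {N : ℕ} {x : Fin (N + 1) → ℝ}

theorem foldMap_eq_of_uniform {d : ℝ} (hd : 0 < d) (hN : 0 < N)
    (h : ∀ i : Fin N, x i.succ - x i.castSucc = d) (i : Fin N) (t : ℝ) :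
    foldMap x i t = if Even (i : ℕ) then x 0 + i * d + (t - x 0) / N
      else x 0 + (i + 1) * d - (t - x 0) / N := by
  have hN' : (N : ℝ) ≠ 0 := by positivity
  have e1 := node_eq_of_uniform h i.castSucc
  have e2 := node_eq_of_uniform h i.succ
  have e3 := node_eq_of_uniform h (Fin.last N)
  simp only [Fin.val_succ, Fin.val_castSucc, Fin.val_last] at e1 e2 e3
  push_cast at e2
  unfold foldMap
  rw [e1, e2, e3]
  split_ifs <;> field_simp <;> ring

theorem abs_foldMap_sub_of_uniform {d : ℝ} (hd : 0 < d) (hN : 0 < N)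
    (h : ∀ i : Fin N, x i.succ - x i.castSucc = d) (i : Fin N) (s t : ℝ) :
    |foldMap x i s - foldMap x i t| = |s - t| / N := by
  rw [foldMap_eq_of_uniform hd hN h, foldMap_eq_of_uniform hd hN h]
  have hN' : (0 : ℝ) < N := by positivity
  rw [← abs_of_pos hN', ← abs_div, abs_of_pos hN']
  split_ifs
  · congr 1; ring
  · rw [← abs_neg]; congr 1; ring

end FoldMap

namespace FISData

variable {N : ℕ} (P : FISData N)

/-- The side of the domain. -/
noncomputable def side : ℝ := P.x (Fin.last N) - P.x 0

variable {P}

theorem side_pos (hN : 2 ≤ N) : 0 < P.side := by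
  refine sub_pos.2 (P.x_strictMono ?_)
  rw [Fin.lt_def]; simp; omega

theorem IsUniform.x_step (h : P.IsUniform) (i : Fin N) :
    P.x i.succ - P.x i.castSucc = P.side / N := h.2.1 i

theorem IsUniform.y_step (h : P.IsUniform) (i : Fin N) :
    P.y i.succ - P.y i.castSucc = P.side / N := by
  rw [h.2.2 i, ← h.1, side]

theorem IsUniform.mem_D_iff (h : P.IsUniform) {t : ℝ × ℝ} : t ∈ P.D ↔
    (P.x 0 ≤ t.1 ∧ t.1 ≤ P.x 0 + P.side) ∧ (P.y 0 ≤ t.2 ∧ t.2 ≤ P.y 0 + P.side) := by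
  have e : P.y 0 + P.side = P.y (Fin.last N) := by rw [side, h.1]; ring
  have e' : P.x 0 + P.side = P.x (Fin.last N) := by rw [side]; ring
  rw [e, e']; rfl

theorem corner_mem_D (h : P.IsUniform) (hN : 2 ≤ N) : (P.x 0, P.y 0) ∈ P.D := by
  have := side_pos (P := P) hN
  rw [h.mem_D_iff]; simp; linarith

theorem isCompact_D : IsCompact P.D := isCompact_Icc.prod isCompact_Icc

theorem isPreconnected_D : IsPreconnected P.D := isPreconnected_Icc.prod isPreconnected_Icc

theorem dist_le_side (h : P.IsUniform) {s t : ℝ × ℝ} (hs : s ∈ P.D) (ht : t ∈ P.D) :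
    dist s t ≤ P.side := by
  rw [h.mem_D_iff] at hs ht
  rw [Prod.dist_eq, Real.dist_eq, Real.dist_eq]
  refine max_le (abs_le.2 ⟨?_, ?_⟩) (abs_le.2 ⟨?_, ?_⟩) <;> linarith

theorem dist_L (hN : 2 ≤ N) (h : P.IsUniform) (w : Fin N × Fin N) (s t : ℝ × ℝ) :
    dist (P.L w s) (P.L w t) = dist s t / N := by
  have hd : 0 < P.side / N := div_pos (side_pos hN) (by positivity)
  have hN0 : 0 < N := by omega
  simp only [L, Prod.dist_eq, Real.dist_eq]
  rw [abs_foldMap_sub_of_uniform hd hN0 h.x_step, abs_foldMap_sub_of_uniform hd hN0 h.y_step]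
  exact (max_div_div_right (by positivity) _ _)

/-! ### The functional equation -/

section FIF

variable {f : ℝ × ℝ → ℝ}

/-- The point Ψ_w(t, f t) lies on the graph by invariance: its first two coordinates give membership
in D, with no geometry of the folding maps, and its third gives the functional equation. -/
theorem IsFIF.L_mem_and_eq (hf : P.IsFIF f) (w : Fin N × Fin N) {t : ℝ × ℝ} (ht : t ∈ P.D) :
    P.L w t ∈ P.D ∧ f (P.L w t) = P.F w t (f t) := by
  have : P.Psi w ![t.1, t.2, f t] ∈ P.graph f := by
    rw [hf.invariant]
    exact Set.mem_iUnion.2 ⟨w, _, ⟨t, ht, rfl⟩, rfl⟩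
  obtain ⟨s, hs, he⟩ := this
  have e0 := congrFun he 0
  have e1 := congrFun he 1
  have e2 := congrFun he 2
  simp [Psi] at e0 e1 e2
  have : s = P.L w t := Prod.ext e0 e1
  subst this
  exact ⟨hs, e2⟩

theorem IsFIF.L_mem (hf : P.IsFIF f) (w : Fin N × Fin N) {t : ℝ × ℝ} (ht : t ∈ P.D) :
    P.L w t ∈ P.D := (hf.L_mem_and_eq w ht).1

theorem IsFIF.exists_L_eq (hf : P.IsFIF f) {t : ℝ × ℝ} (ht : t ∈ P.D) :
    ∃ w, ∃ s ∈ P.D, P.L w s = t := by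
  have : ![t.1, t.2, f t] ∈ P.graph f := ⟨t, ht, rfl⟩
  rw [hf.invariant] at this
  obtain ⟨w, _, ⟨s, hs, rfl⟩, he⟩ := Set.mem_iUnion.1 this
  have e0 := congrFun he 0
  have e1 := congrFun he 1
  simp [Psi] at e0 e1
  exact ⟨w, s, hs, Prod.ext e0 e1⟩

theorem IsFIF.apply_L (hf : P.IsFIF f) {q : ℝ × ℝ → ℝ} (hq : P.IsOffset q)
    (w : Fin N × Fin N) {t : ℝ × ℝ} (ht : t ∈ P.D) :
    f (P.L w t) = P.S (P.L w t) * f t + q (P.L w t) := by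
  rw [(hf.L_mem_and_eq w ht).2, hq w t ht, F]; ring

/-! ### Words and cells -/

theorem IsFIF.wordMap_mem (hf : P.IsFIF f) {n : ℕ} (w : Fin n → Fin N × Fin N) {t : ℝ × ℝ}
    (ht : t ∈ P.D) : P.wordMap n w t ∈ P.D := by
  induction n with
  | zero => exact ht
  | succ n ih => exact hf.L_mem _ (ih (Fin.tail w))

theorem IsFIF.cell_subset (hf : P.IsFIF f) {n : ℕ} (w : Fin n → Fin N × Fin N) :
    P.cell w ⊆ P.D := by
  rintro _ ⟨t, ht, rfl⟩
  exact hf.wordMap_mem w ht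

theorem wordMap_cons {n : ℕ} (l : Fin N × Fin N) (w : Fin n → Fin N × Fin N) (t : ℝ × ℝ) :
    P.wordMap (n + 1) (Fin.cons l w : Fin (n + 1) → Fin N × Fin N) t
      = P.L l (P.wordMap n w t) := by
  simp [wordMap]

theorem cell_cons {n : ℕ} (l : Fin N × Fin N) (w : Fin n → Fin N × Fin N) :
    P.cell (Fin.cons l w : Fin (n + 1) → Fin N × Fin N) = P.L l '' P.cell w := by
  simp only [cell, Set.image_image, wordMap_cons]

theorem wordMap_snoc {n : ℕ} (w : Fin n → Fin N × Fin N) (l : Fin N × Fin N) (t : ℝ × ℝ) :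
    P.wordMap (n + 1) (Fin.snoc w l : Fin (n + 1) → Fin N × Fin N) t
      = P.wordMap n w (P.L l t) := by
  induction n with
  | zero => simp [wordMap, Fin.snoc]
  | succ n ih =>
    obtain ⟨a, w, rfl⟩ : ∃ a w', w = Fin.cons a w' :=
      ⟨w 0, Fin.tail w, (Fin.cons_self_tail w).symm⟩
    rw [← Fin.cons_snoc_eq_snoc_cons, wordMap_cons, ih, wordMap_cons]

theorem IsFIF.cell_snoc_subset (hf : P.IsFIF f) {n : ℕ} (w : Fin n → Fin N × Fin N)
    (l : Fin N × Fin N) :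
    P.cell (Fin.snoc w l : Fin (n + 1) → Fin N × Fin N) ⊆ P.cell w := by
  rintro _ ⟨t, ht, rfl⟩
  rw [wordMap_snoc]
  exact ⟨_, hf.L_mem l ht, rfl⟩

theorem IsFIF.exists_mem_cell (hf : P.IsFIF f) (n : ℕ) {t : ℝ × ℝ} (ht : t ∈ P.D) :
    ∃ w : Fin n → Fin N × Fin N, t ∈ P.cell w := by
  induction n generalizing t with
  | zero => exact ⟨Fin.elim0, t, ht, rfl⟩
  | succ n ih =>
    obtain ⟨l, s, hs, rfl⟩ := hf.exists_L_eq ht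
    obtain ⟨w, hw⟩ := ih hs
    exact ⟨Fin.cons l w, by rw [cell_cons]; exact ⟨s, hw, rfl⟩⟩

theorem dist_wordMap (hN : 2 ≤ N) (h : P.IsUniform) {n : ℕ} (w : Fin n → Fin N × Fin N)
    (s t : ℝ × ℝ) : dist (P.wordMap n w s) (P.wordMap n w t) = dist s t / N ^ n := by
  induction n with
  | zero => simp [wordMap]
  | succ n ih =>
    simp only [wordMap, Function.comp]
    rw [dist_L hN h, ih, pow_succ, div_div]

theorem dist_le_of_mem_cell (hN : 2 ≤ N) (h : P.IsUniform) {n : ℕ} {w : Fin n → Fin N × Fin N}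
    {s t : ℝ × ℝ} (hs : s ∈ P.cell w) (ht : t ∈ P.cell w) : dist s t ≤ P.side / N ^ n := by
  obtain ⟨s, hs, rfl⟩ := hs
  obtain ⟨t, ht, rfl⟩ := ht
  rw [dist_wordMap hN h]
  gcongr
  exact dist_le_side h hs ht

theorem cell_nonempty (hN : 2 ≤ N) (h : P.IsUniform) {n : ℕ} (w : Fin n → Fin N × Fin N) :
    (P.cell w).Nonempty := ⟨_, _, corner_mem_D h hN, rfl⟩

theorem isPreconnected_cell (hN : 2 ≤ N) (h : P.IsUniform) {n : ℕ} (w : Fin n → Fin N × Fin N) :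
    IsPreconnected (P.cell w) := by
  refine isPreconnected_D.image _ (Continuous.continuousOn ?_)
  have : LipschitzWith 1 (P.wordMap n w) := LipschitzWith.of_dist_le_mul fun s t => by
    rw [dist_wordMap hN h]
    simp only [NNReal.coe_one, one_mul]
    have : (1 : ℝ) ≤ N ^ n := one_le_pow₀ (by exact_mod_cast (by omega : 1 ≤ N))
    exact div_le_self dist_nonneg this
  exact this.continuous

theorem sum_cons {n : ℕ} (φ : (Fin (n + 1) → Fin N × Fin N) → ℝ) :
    ∑ w, φ w = ∑ l : Fin N × Fin N, ∑ w : Fin n → Fin N × Fin N, φ (Fin.cons l w) := by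
  rw [← (Fin.consEquiv (fun _ : Fin (n + 1) => Fin N × Fin N)).sum_comp, Fintype.sum_prod_type]
  rfl

end FIF

/-! ### Iterates of the transfer operator -/

variable (P) in
/-- The iterates, applied to the constant function `1`, of the transfer operator with
weight `|S|`. -/
noncomputable def transfer : ℕ → ℝ × ℝ → ℝ
  | 0, _ => 1
  | p + 1, t => ∑ w, |P.S (P.L w t)| * transfer p (P.L w t)

theorem transfer_nonneg (p : ℕ) (t : ℝ × ℝ) : 0 ≤ P.transfer p t := by
  induction p generalizing t with
  | zero => simp [transfer]
  | succ p ih => exact Finset.sum_nonneg fun w _ => mul_nonneg (abs_nonneg _) (ih _)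

/-- `log |S|` is Lipschitz on the domain with constant `κ`. -/
def LogLip (P : FISData N) (κ : ℝ) : Prop :=
  0 ≤ κ ∧ (∀ t ∈ P.D, 0 < |P.S t|) ∧
    ∀ s ∈ P.D, ∀ t ∈ P.D, |P.S s| ≤ Real.exp (κ * dist s t) * |P.S t|

/-- By compactness |S| ≥ m > 0, so |S s| ≤ |S t| + K d ≤ (1 + K d / m) |S t| ≤ exp(K d / m) |S t|,
where d is the distance from s to t. -/
theorem exists_logLip (hS : ∃ K, LipschitzOnWith K P.S P.D)
    (hsign : (∀ t ∈ P.D, 0 < P.S t) ∨ (∀ t ∈ P.D, P.S t < 0)) : ∃ κ, P.LogLip κ := by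
  obtain ⟨K, hK⟩ := hS
  have hpos : ∀ t ∈ P.D, 0 < |P.S t| := fun t ht => abs_pos.2 <|
    hsign.elim (fun h => (h t ht).ne') (fun h => (h t ht).ne)
  obtain ⟨m, hm, hmS⟩ : ∃ m : ℝ, 0 < m ∧ ∀ t ∈ P.D, m ≤ |P.S t| := by
    rcases P.D.eq_empty_or_nonempty with he | hne
    · exact ⟨1, one_pos, by simp [he]⟩
    · obtain ⟨t, ht, hmin⟩ := isCompact_D.exists_isMinOn hne P.S_continuousOn.abs
      exact ⟨_, hpos t ht, fun s hs => hmin hs⟩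
  refine ⟨K / m, by positivity, hpos, fun s hs t ht => ?_⟩
  have h1 := hK.dist_le_mul s hs t ht
  rw [Real.dist_eq] at h1
  have h2 : |P.S s| ≤ |P.S t| + K * dist s t := by
    have := abs_sub_abs_le_abs_sub (P.S s) (P.S t); linarith
  have h3 : K * dist s t ≤ (K / m * dist s t) * |P.S t| := by
    calc K * dist s t = (K / m * dist s t) * m := by field_simp
      _ ≤ _ := by gcongr; exact hmS t ht
  have h4 := Real.add_one_le_exp (K / m * dist s t)
  have := mul_le_mul_of_nonneg_right h4 (hpos t ht).le
  linarith

section Transfer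

variable {f : ℝ × ℝ → ℝ} {κ : ℝ}

theorem transfer_pos (hN : 2 ≤ N) (hf : P.IsFIF f) (hκ : P.LogLip κ) (p : ℕ) {t : ℝ × ℝ}
    (ht : t ∈ P.D) : 0 < P.transfer p t := by
  have : NeZero N := ⟨by omega⟩
  induction p generalizing t with
  | zero => simp [transfer]
  | succ p ih =>
    exact Finset.sum_pos (fun w _ => mul_pos (hκ.2.1 _ (hf.L_mem w ht)) (ih (hf.L_mem w ht)))
      Finset.univ_nonempty

/-- Bounded distortion: the weight and the inductive hypothesis each contribute exp(κ d / N), and 2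
/ N ≤ 1, so the constant does not deteriorate with p. -/
theorem transfer_le_exp (hN : 2 ≤ N) (h : P.IsUniform) (hf : P.IsFIF f) (hκ : P.LogLip κ) (p : ℕ)
    {s t : ℝ × ℝ} (hs : s ∈ P.D) (ht : t ∈ P.D) :
    P.transfer p s ≤ Real.exp (κ * dist s t) * P.transfer p t := by
  induction p generalizing s t with
  | zero =>
    simp only [transfer, mul_one]
    exact Real.one_le_exp (mul_nonneg hκ.1 dist_nonneg)
  | succ p ih =>
    simp only [transfer]
    rw [Finset.mul_sum]
    refine Finset.sum_le_sum fun w _ => ?_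
    have h1 := hκ.2.2 _ (hf.L_mem w hs) _ (hf.L_mem w ht)
    have h2 := ih (hf.L_mem w hs) (hf.L_mem w ht)
    have h3 : Real.exp (κ * dist (P.L w s) (P.L w t)) * Real.exp (κ * dist (P.L w s) (P.L w t))
        ≤ Real.exp (κ * dist s t) := by
      rw [← Real.exp_add, Real.exp_le_exp, ← mul_add, dist_L hN h, ← add_div]
      refine mul_le_mul_of_nonneg_left ?_ hκ.1
      have : (2 : ℝ) ≤ N := by exact_mod_cast hN
      rw [div_le_iff₀ (by positivity)]
      nlinarith [dist_nonneg (x := s) (y := t)]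
    calc |P.S (P.L w s)| * P.transfer p (P.L w s)
        ≤ (Real.exp (κ * dist (P.L w s) (P.L w t)) * |P.S (P.L w t)|) *
          (Real.exp (κ * dist (P.L w s) (P.L w t)) * P.transfer p (P.L w t)) :=
          mul_le_mul h1 h2 (transfer_nonneg _ _) (by positivity)
      _ = (Real.exp (κ * dist (P.L w s) (P.L w t)) * Real.exp (κ * dist (P.L w s) (P.L w t))) *
          (|P.S (P.L w t)| * P.transfer p (P.L w t)) := by ring
      _ ≤ _ := mul_le_mul_of_nonneg_right h3 (mul_nonneg (abs_nonneg _) (transfer_nonneg _ _))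

/-- T^(p+k) 1 = T^k (T^p 1), where T^p 1 is within a factor C of the constant T^p 1(t₀); the
positive operator T^k preserves this comparison with the same C. -/
theorem transfer_add_bounds (hf : P.IsFIF f) {C : ℝ}
    (hC : ∀ p, ∀ s ∈ P.D, ∀ t ∈ P.D, P.transfer p s ≤ C * P.transfer p t)
    {t₀ : ℝ × ℝ} (ht₀ : t₀ ∈ P.D) (p k : ℕ) {t : ℝ × ℝ} (ht : t ∈ P.D) :
    P.transfer (p + k) t ≤ C * (P.transfer p t₀ * P.transfer k t) ∧
      P.transfer p t₀ * P.transfer k t ≤ C * P.transfer (p + k) t := by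
  induction k generalizing t with
  | zero => simpa [transfer] using ⟨hC p t ht t₀ ht₀, hC p t₀ ht₀ t ht⟩
  | succ k ih =>
    rw [← add_assoc]
    simp only [transfer, Finset.mul_sum]
    constructor
    · refine Finset.sum_le_sum fun w _ => ?_
      have := mul_le_mul_of_nonneg_left (ih (hf.L_mem w ht)).1 (abs_nonneg (P.S (P.L w t)))
      linarith
    · refine Finset.sum_le_sum fun w _ => ?_
      have := mul_le_mul_of_nonneg_left (ih (hf.L_mem w ht)).2 (abs_nonneg (P.S (P.L w t)))
      linarith

/-- The iterates of the transfer operator grow like `r ^ p`. -/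
theorem exists_transfer_growth (hN : 2 ≤ N) (h : P.IsUniform) (hf : P.IsFIF f)
    (hκ : P.LogLip κ) : ∃ r C : ℝ, 0 < r ∧ 0 < C ∧
      ∀ p, ∀ t ∈ P.D, r ^ p ≤ C * P.transfer p t ∧ P.transfer p t ≤ C * r ^ p := by
  set C := Real.exp (κ * P.side) with hCdef
  have hC1 : 1 ≤ C := Real.one_le_exp (mul_nonneg hκ.1 (side_pos hN).le)
  have hC : ∀ p, ∀ s ∈ P.D, ∀ t ∈ P.D, P.transfer p s ≤ C * P.transfer p t := by
    intro p s hs t ht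
    refine (transfer_le_exp hN h hf hκ p hs ht).trans ?_
    refine mul_le_mul_of_nonneg_right (Real.exp_le_exp.2 ?_) (transfer_nonneg _ _)
    exact mul_le_mul_of_nonneg_left (dist_le_side h hs ht) hκ.1
  have ht₀ := corner_mem_D h hN
  obtain ⟨r, hr, hb⟩ := exists_pow_comparable (b := fun p => P.transfer p (P.x 0, P.y 0)) hC1
    (fun p => transfer_pos hN hf hκ p ht₀)
    (fun p k => (transfer_add_bounds hf hC ht₀ p k ht₀).1)
    (fun p k => (transfer_add_bounds hf hC ht₀ p k ht₀).2)
  refine ⟨r, C * C, hr, by positivity, fun p t ht => ⟨?_, ?_⟩⟩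
  · refine (hb p).1.trans ?_
    rw [mul_assoc]
    exact mul_le_mul_of_nonneg_left (hC p _ ht₀ t ht) (by positivity)
  · refine (hC p t ht _ ht₀).trans ?_
    rw [mul_assoc]
    exact mul_le_mul_of_nonneg_left (hb p).2 (by positivity)

end Transfer

/-! ### The vertical scaling matrices -/

section Matrices

variable {f : ℝ × ℝ → ℝ} {κ : ℝ}

theorem IsFIF.bddAbove_abs_S (hf : P.IsFIF f) {n : ℕ} (w : Fin n → Fin N × Fin N) :
    BddAbove ((fun t => |P.S t|) '' P.cell w) := by
  refine ⟨1, ?_⟩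
  rintro _ ⟨t, ht, rfl⟩
  exact (P.abs_S_lt_one t (hf.cell_subset w ht)).le

theorem bddBelow_abs_S {n : ℕ} (w : Fin n → Fin N × Fin N) :
    BddBelow ((fun t => |P.S t|) '' P.cell w) := by
  refine ⟨0, ?_⟩
  rintro _ ⟨t, _, rfl⟩
  exact abs_nonneg _

theorem IsFIF.le_upS (hf : P.IsFIF f) {n : ℕ} {w : Fin n → Fin N × Fin N} {t : ℝ × ℝ}
    (ht : t ∈ P.cell w) : |P.S t| ≤ P.upS w :=
  le_csSup (hf.bddAbove_abs_S w) ⟨t, ht, rfl⟩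

theorem lowS_le {n : ℕ} {w : Fin n → Fin N × Fin N} {t : ℝ × ℝ}
    (ht : t ∈ P.cell w) : P.lowS w ≤ |P.S t| :=
  csInf_le (bddBelow_abs_S w) ⟨t, ht, rfl⟩

theorem lowS_nonneg {n : ℕ} (w : Fin n → Fin N × Fin N) : 0 ≤ P.lowS w := by
  refine Real.sInf_nonneg ?_
  rintro _ ⟨t, _, rfl⟩
  exact abs_nonneg _

theorem upS_nonneg {n : ℕ} (w : Fin n → Fin N × Fin N) : 0 ≤ P.upS w := by
  refine Real.sSup_nonneg ?_
  rintro _ ⟨t, _, rfl⟩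
  exact abs_nonneg _

theorem upS_le_mul_lowS (hN : 2 ≤ N) (h : P.IsUniform) (hf : P.IsFIF f) (hκ : P.LogLip κ)
    {n : ℕ} (w : Fin n → Fin N × Fin N) :
    P.upS w ≤ Real.exp (κ * (P.side / N ^ n)) * P.lowS w := by
  have hne := (cell_nonempty hN h w).image (fun t => |P.S t|)
  refine csSup_le hne ?_
  rintro _ ⟨s, hs, rfl⟩
  rw [← div_le_iff₀' (Real.exp_pos _)]
  refine le_csInf hne ?_
  rintro _ ⟨t, ht, rfl⟩
  simp only
  rw [div_le_iff₀' (Real.exp_pos _)]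
  refine (hκ.2.2 s (hf.cell_subset w hs) t (hf.cell_subset w ht)).trans ?_
  refine mul_le_mul_of_nonneg_right (Real.exp_le_exp.2 ?_) (abs_nonneg _)
  exact mul_le_mul_of_nonneg_left (dist_le_of_mem_cell hN h hs ht) hκ.1

/-- The only rows with a nonzero entry in column j are the words l j_1 ⋯ j_n, and the corresponding
entry belongs to the word lj. A row vector times the matrix is thus a sum over one new first letter,
as in the transfer operator. -/
theorem sum_mul_shift {n : ℕ} (u : (Fin (n + 1) → Fin N × Fin N) → ℝ)
    (σ : (Fin (n + 2) → Fin N × Fin N) → ℝ) (j : Fin (n + 1) → Fin N × Fin N) :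
    ∑ i, u i * (if Fin.tail i = Fin.init j then
        σ (Fin.snoc i (j (Fin.last n)) : Fin (n + 2) → Fin N × Fin N) else 0)
      = ∑ l : Fin N × Fin N, u (Fin.cons l (Fin.init j)) * σ (Fin.cons l j) := by
  rw [sum_cons]
  refine Finset.sum_congr rfl fun l _ => ?_
  rw [Finset.sum_eq_single (Fin.init j)]
  · rw [Fin.tail_cons, if_pos rfl, ← Fin.cons_snoc_eq_snoc_cons, Fin.snoc_init_self]
  · intro w _ hw
    rw [Fin.tail_cons, if_neg hw, mul_zero]
  · simp

theorem IsFIF.L_mem_cell_cons_init (hf : P.IsFIF f) {n : ℕ} {j : Fin (n + 1) → Fin N × Fin N}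
    (l : Fin N × Fin N) {t : ℝ × ℝ} (ht : t ∈ P.cell j) :
    P.L l t ∈ P.cell (Fin.cons l (Fin.init j) : Fin (n + 1) → Fin N × Fin N) := by
  rw [cell_cons]
  refine ⟨t, ?_, rfl⟩
  rw [← Fin.snoc_init_self j] at ht
  exact hf.cell_snoc_subset _ _ ht

/-- Column sums of powers obey the recursion of `transfer` with |S(L_l t)| replaced by its supremum
over the cell of lj, which contains L_l t when t is in the cell of j. -/
theorem transfer_le_colSum_upM (hf : P.IsFIF f) (n m : ℕ) {j : Fin (n + 1) → Fin N × Fin N}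
    {t : ℝ × ℝ} (ht : t ∈ P.cell j) : P.transfer m t ≤ ∑ i, ((P.upM n) ^ m) i j := by
  induction m generalizing j t with
  | zero => simp [transfer, Matrix.one_apply]
  | succ m ih =>
    simp only [pow_succ, Matrix.mul_apply]
    rw [Finset.sum_comm]
    simp only [← Finset.sum_mul]
    simp only [upM]
    rw [sum_mul_shift (fun k => ∑ i, ((P.upM n) ^ m) i k) P.upS j, transfer]
    refine Finset.sum_le_sum fun l _ => ?_
    rw [mul_comm]
    have h1 := ih (hf.L_mem_cell_cons_init l ht)
    refine mul_le_mul h1 (hf.le_upS ?_) (abs_nonneg _) ((transfer_nonneg _ _).trans h1)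
    rw [cell_cons]; exact ⟨t, ht, rfl⟩

theorem colSum_lowM_le_transfer (hf : P.IsFIF f) (n m : ℕ) {j : Fin (n + 1) → Fin N × Fin N}
    {t : ℝ × ℝ} (ht : t ∈ P.cell j) : ∑ i, ((P.lowM n) ^ m) i j ≤ P.transfer m t := by
  induction m generalizing j t with
  | zero => simp [transfer, Matrix.one_apply]
  | succ m ih =>
    simp only [pow_succ, Matrix.mul_apply]
    rw [Finset.sum_comm]
    simp only [← Finset.sum_mul]
    simp only [lowM]
    rw [sum_mul_shift (fun k => ∑ i, ((P.lowM n) ^ m) i k) P.lowS j, transfer]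
    refine Finset.sum_le_sum fun l _ => ?_
    rw [mul_comm]
    have h1 := ih (hf.L_mem_cell_cons_init l ht)
    refine mul_le_mul (lowS_le ?_) h1 ?_ (abs_nonneg _)
    · rw [cell_cons]; exact ⟨t, ht, rfl⟩
    · refine Finset.sum_nonneg fun i _ => matrix_pow_nonneg (fun i j => ?_) m _ _
      simp only [lowM]
      split_ifs
      exacts [lowS_nonneg _, le_rfl]

theorem upM_nonneg (n : ℕ) (i j) : 0 ≤ P.upM n i j := by
  unfold upM
  split_ifs
  exacts [upS_nonneg _, le_rfl]

theorem lowM_nonneg (n : ℕ) (i j) : 0 ≤ P.lowM n i j := by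
  unfold lowM
  split_ifs
  exacts [lowS_nonneg _, le_rfl]

theorem upM_le_mul_lowM (hN : 2 ≤ N) (h : P.IsUniform) (hf : P.IsFIF f) (hκ : P.LogLip κ)
    (n : ℕ) (i j) : P.upM n i j ≤ Real.exp (κ * (P.side / N ^ (n + 2))) * P.lowM n i j := by
  unfold upM lowM
  split_ifs
  · exact upS_le_mul_lowS hN h hf hκ _
  · simp

theorem sum_upM_pow_lower (hN : 2 ≤ N) (h : P.IsUniform) (hf : P.IsFIF f) {r C : ℝ} (hC : 0 < C)
    (hr : ∀ p, ∀ t ∈ P.D, r ^ p ≤ C * P.transfer p t) (n m : ℕ) :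
    C⁻¹ * r ^ m ≤ ∑ i, ∑ j, ((P.upM n) ^ m) i j := by
  have : NeZero N := ⟨by omega⟩
  refine le_of_le_of_eq ?_ (Finset.sum_comm (f := fun j i => ((P.upM n) ^ m) i j))
  let j₀ : Fin (n + 1) → Fin N × Fin N := fun _ => 0
  obtain ⟨t, ht⟩ := cell_nonempty hN h j₀
  refine le_trans ?_ (Finset.single_le_sum
    (f := fun j => ∑ i, ((P.upM n) ^ m) i j) (fun j _ => Finset.sum_nonneg fun i _ =>
      matrix_pow_nonneg (upM_nonneg n) m i j) (Finset.mem_univ j₀))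
  refine le_trans ?_ (transfer_le_colSum_upM hf n m ht)
  rw [inv_mul_le_iff₀ hC]
  exact hr m t (hf.cell_subset _ ht)

theorem sum_lowM_pow_upper (hN : 2 ≤ N) (h : P.IsUniform) (hf : P.IsFIF f) {r C : ℝ}
    (hr : ∀ p, ∀ t ∈ P.D, P.transfer p t ≤ C * r ^ p) (n m : ℕ) :
    ∑ i, ∑ j, ((P.lowM n) ^ m) i j
      ≤ (Fintype.card (Fin (n + 1) → Fin N × Fin N) * C) * r ^ m := by
  refine le_of_eq_of_le (Finset.sum_comm (f := fun i j => ((P.lowM n) ^ m) i j)) ?_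
  calc ∑ j, ∑ i, ((P.lowM n) ^ m) i j
      ≤ ∑ _j : Fin (n + 1) → Fin N × Fin N, C * r ^ m := by
        refine Finset.sum_le_sum fun j _ => ?_
        obtain ⟨t, ht⟩ := cell_nonempty hN h j
        exact (colSum_lowM_le_transfer hf n m ht).trans (hr m t (hf.cell_subset _ ht))
    _ = _ := by rw [Finset.sum_const, nsmul_eq_mul, Finset.card_univ]; ring

theorem tendsto_specRad_upM_lowM (hN : 2 ≤ N) (h : P.IsUniform) (hf : P.IsFIF f)
    (hκ : P.LogLip κ) {r C : ℝ} (hr0 : 0 < r) (hC : 0 < C)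
    (hr : ∀ p, ∀ t ∈ P.D, r ^ p ≤ C * P.transfer p t ∧ P.transfer p t ≤ C * r ^ p) :
    Tendsto (fun n => specRad (P.upM n)) atTop (𝓝 r) ∧
      Tendsto (fun n => specRad (P.lowM n)) atTop (𝓝 r) := by
  have : NeZero N := ⟨by omega⟩
  set c : ℕ → ℝ := fun n => Real.exp (κ * (P.side / N ^ (n + 2))) with hc
  have hcpos : ∀ n, 0 < c n := fun n => Real.exp_pos _
  have hc1 : Tendsto c atTop (𝓝 1) := by
    have h1 : Tendsto (fun n : ℕ => P.side / (N : ℝ) ^ (n + 2)) atTop (𝓝 0) := by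
      refine Tendsto.div_atTop tendsto_const_nhds ?_
      refine (tendsto_pow_atTop_atTop_of_one_lt ?_).comp (tendsto_add_atTop_nat 2)
      exact_mod_cast (by omega : 1 < N)
    have h2 := (Real.continuous_exp.tendsto _).comp (h1.const_mul κ)
    rw [mul_zero, Real.exp_zero] at h2
    exact h2
  have hlow := fun n m => sum_upM_pow_lower hN h hf hC (fun p t ht => (hr p t ht).1) n m
  have hupp := fun n m => sum_lowM_pow_upper hN h hf (fun p t ht => (hr p t ht).2) n m
  have hcmp : ∀ n m, ∑ i, ∑ j, ((P.upM n) ^ m) i j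
      ≤ c n ^ m * ∑ i, ∑ j, ((P.lowM n) ^ m) i j := by
    intro n m
    rw [Finset.mul_sum]
    refine Finset.sum_le_sum fun i _ => ?_
    rw [Finset.mul_sum]
    exact Finset.sum_le_sum fun j _ => matrix_pow_le_pow_mul (upM_nonneg n)
      (upM_le_mul_lowM hN h hf hκ n) m i j
  have hcard : ∀ n, (0 : ℝ) < Fintype.card (Fin (n + 1) → Fin N × Fin N) * C := fun n =>
    mul_pos (by exact_mod_cast Fintype.card_pos) hC
  -- Two of the four bounds come directly from the growth of `transfer`; the other two cross over
  -- between the matrices at the cost of `c n`.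
  have u1 : ∀ n, r ≤ specRad (P.upM n) := fun n =>
    le_specRad_of_le_sum_pow (upM_nonneg n) (inv_pos.2 hC) hr0.le (hlow n)
  have u2 : ∀ n, specRad (P.upM n) ≤ c n * r := fun n =>
    specRad_le_of_sum_pow_le (upM_nonneg n) (hcard n) (mul_nonneg (hcpos n).le hr0.le) fun m => by
      refine (hcmp n m).trans ((mul_le_mul_of_nonneg_left (hupp n m)
        (pow_nonneg (hcpos n).le m)).trans (le_of_eq ?_))
      rw [mul_pow]; ring
  have l2 : ∀ n, specRad (P.lowM n) ≤ r := fun n =>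
    specRad_le_of_sum_pow_le (lowM_nonneg n) (hcard n) hr0.le (hupp n)
  have l1 : ∀ n, r / c n ≤ specRad (P.lowM n) := fun n =>
    le_specRad_of_le_sum_pow (lowM_nonneg n) (inv_pos.2 hC) (div_nonneg hr0.le (hcpos n).le)
      fun m => by
        rw [div_pow, ← mul_div_assoc, div_le_iff₀' (pow_pos (hcpos n) m)]
        exact (hlow n m).trans (hcmp n m)
  refine ⟨tendsto_of_tendsto_of_tendsto_of_le_of_le tendsto_const_nhds ?_ u1 u2,
    tendsto_of_tendsto_of_tendsto_of_le_of_le ?_ tendsto_const_nhds l1 l2⟩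
  · simpa using hc1.mul_const r
  · have := (tendsto_const_nhds (x := r)).div hc1 one_ne_zero
    rw [div_one] at this
    exact this

end Matrices

end FISData

/-! ### Oscillation -/

theorem sub_le_osc {φ : ℝ × ℝ → ℝ} {E : Set (ℝ × ℝ)} {B : ℝ} (hB : ∀ a ∈ E, |φ a| ≤ B)
    {a b : ℝ × ℝ} (ha : a ∈ E) (hb : b ∈ E) : φ a - φ b ≤ osc φ E := by
  refine le_csSup ⟨2 * B, ?_⟩ ⟨a, ha, b, hb, rfl⟩
  rintro _ ⟨a, ha, b, hb, rfl⟩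
  have h1 := abs_le.1 (hB a ha)
  have h2 := abs_le.1 (hB b hb)
  linarith

theorem osc_le {φ : ℝ × ℝ → ℝ} {E : Set (ℝ × ℝ)} (hE : E.Nonempty) {M : ℝ}
    (h : ∀ a ∈ E, ∀ b ∈ E, φ a - φ b ≤ M) : osc φ E ≤ M := by
  obtain ⟨a, ha⟩ := hE
  refine csSup_le ⟨_, a, ha, a, ha, rfl⟩ ?_
  rintro _ ⟨a, ha, b, hb, rfl⟩
  exact h a ha b hb

theorem osc_nonneg {φ : ℝ × ℝ → ℝ} {E : Set (ℝ × ℝ)} {B : ℝ} (hE : E.Nonempty)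
    (hB : ∀ a ∈ E, |φ a| ≤ B) : 0 ≤ osc φ E := by
  obtain ⟨a, ha⟩ := hE
  simpa using sub_le_osc hB ha ha

/-- If `φ ∘ L` is close to `σ φ` up to constants, then so are the oscillations. -/
theorem abs_osc_image_sub_le {φ : ℝ × ℝ → ℝ} {L : ℝ × ℝ → ℝ × ℝ} {E : Set (ℝ × ℝ)} {B σ ε : ℝ}
    (hE : E.Nonempty) (hB : ∀ a ∈ E, |φ a| ≤ B) (hB' : ∀ a ∈ L '' E, |φ a| ≤ B) (hσ : σ ≠ 0)
    (h : ∀ a ∈ E, ∀ b ∈ E, |φ (L a) - φ (L b) - σ * (φ a - φ b)| ≤ ε) :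
    |osc φ (L '' E) - (|σ| * osc φ E)| ≤ ε := by
  have hσ' := abs_pos.2 hσ
  rw [abs_le]
  constructor
  · have : osc φ E ≤ (osc φ (L '' E) + ε) / |σ| := by
      refine osc_le hE fun a ha b hb => ?_
      rw [le_div_iff₀ hσ']
      have h1 := abs_le.1 (h a ha b hb)
      have h2 := sub_le_osc hB' ⟨a, ha, rfl⟩ ⟨b, hb, rfl⟩
      have h3 := sub_le_osc hB' ⟨b, hb, rfl⟩ ⟨a, ha, rfl⟩
      rcases abs_cases σ with ⟨e, _⟩ | ⟨e, _⟩ <;> rw [e] <;> linarith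
    rw [le_div_iff₀ hσ'] at this
    linarith
  · have : osc φ (L '' E) ≤ |σ| * osc φ E + ε := by
      refine osc_le (hE.image _) ?_
      rintro _ ⟨a, ha, rfl⟩ _ ⟨b, hb, rfl⟩
      have h1 := abs_le.1 (h a ha b hb)
      have h2 : |φ a - φ b| ≤ osc φ E := abs_sub_le_iff.2 ⟨sub_le_osc hB ha hb, sub_le_osc hB hb ha⟩
      have h3 := mul_le_mul_of_nonneg_left h2 hσ'.le
      rw [← abs_mul] at h3
      have h4 := le_abs_self (σ * (φ a - φ b))
      linarith
    linarith

/-- Solution of a perturbed shift relation `E (p + 1) j ≈ E p (j + 1)`. -/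
theorem abs_shift_sub_le {E : ℕ → ℕ → ℝ} {C r s n : ℝ} (hrs : r ≤ s) (hr : 0 ≤ r) (hns : n < s)
    (hn : 0 ≤ n) (hC : 0 ≤ C) (h : ∀ p j, |E (p + 1) j - E p (j + 1)| ≤ C * n ^ p * r ^ j)
    (p k j : ℕ) :
    |E (p + k) j - E p (j + k)| ≤ C / (s - n) * s ^ j * (s ^ k - n ^ k) * n ^ p := by
  induction k generalizing j with
  | zero => simp
  | succ k ih =>
    have h1 := h (p + k) j
    have h2 := ih (j + 1)
    have h3 : C * n ^ (p + k) * r ^ j ≤ C * n ^ (p + k) * s ^ j := by gcongr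
    -- The errors form a geometric sum, Σ_{i<k} n^i s^(k-1-i) = (s^k - n^k) / (s - n). Allowing s >
    -- r keeps this usable when r ≤ n.
    have h4 : C * n ^ (p + k) * s ^ j + C / (s - n) * s ^ (j + 1) * (s ^ k - n ^ k) * n ^ p
        = C / (s - n) * s ^ j * (s ^ (k + 1) - n ^ (k + 1)) * n ^ p := by
      have : s - n ≠ 0 := by linarith
      field_simp
      ring
    rw [← h4]
    have e : j + 1 + k = j + (k + 1) := by ring
    rw [e] at h2
    rw [← add_assoc]
    have := abs_sub_le (E (p + k + 1) j) (E (p + k) (j + 1)) (E p (j + (k + 1)))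
    linarith

/-! ### Growth of the oscillation sums -/

namespace FISData

variable {N : ℕ} {P : FISData N} {f : ℝ × ℝ → ℝ}

theorem IsFIF.exists_bound (hf : P.IsFIF f) : ∃ B, ∀ t ∈ P.D, |f t| ≤ B := by
  obtain ⟨B, hB⟩ := isCompact_D.exists_bound_of_continuousOn hf.continuousOn
  exact ⟨B, fun t ht => hB t ht⟩

theorem oscSum_nonneg (hN : 2 ≤ N) (h : P.IsUniform) (hf : P.IsFIF f) (p : ℕ) :
    0 ≤ P.oscSum f p := by
  obtain ⟨B, hB⟩ := hf.exists_bound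
  exact Finset.sum_nonneg fun w _ =>
    osc_nonneg (cell_nonempty hN h w) fun a ha => hB a (hf.cell_subset w ha)

/-- On the cell, replacing S(L_l a) by S(L_l t) costs O(N^-p) because S is Lipschitz and f is
bounded; the variation of q has the same order. -/
theorem exists_osc_cell_cons (hN : 2 ≤ N) (h : P.IsUniform) (hf : P.IsFIF f)
    (hS : ∃ K, LipschitzOnWith K P.S P.D) {q : ℝ × ℝ → ℝ} (hq : P.IsOffset q)
    (hqLip : ∃ K, LipschitzOnWith K q P.D) (hS0 : ∀ t ∈ P.D, 0 < |P.S t|) :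
    ∃ C, 0 ≤ C ∧ ∀ (p : ℕ) (l : Fin N × Fin N) (w : Fin p → Fin N × Fin N), ∀ t ∈ P.cell w,
      |osc f (P.cell (Fin.cons l w : Fin (p + 1) → Fin N × Fin N))
        - |P.S (P.L l t)| * osc f (P.cell w)| ≤ C / N ^ p := by
  obtain ⟨K, hK⟩ := hS
  obtain ⟨K', hK'⟩ := hqLip
  obtain ⟨B, hB⟩ := hf.exists_bound
  have hB0 : 0 ≤ B := (abs_nonneg _).trans (hB _ (corner_mem_D h hN))
  have hside := side_pos (P := P) hN
  refine ⟨(2 * B * K + K') * P.side, by positivity, fun p l w t ht => ?_⟩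
  have hsub := hf.cell_subset w
  have hLsub : ∀ a ∈ P.L l '' P.cell w, a ∈ P.D := by
    rintro _ ⟨a, ha, rfl⟩; exact hf.L_mem l (hsub ha)
  have hd : ∀ a ∈ P.cell w, ∀ b ∈ P.cell w, dist (P.L l a) (P.L l b) ≤ P.side / N ^ p := by
    intro a ha b hb
    rw [dist_L hN h]
    refine (div_le_self dist_nonneg ?_).trans (dist_le_of_mem_cell hN h ha hb)
    exact_mod_cast (by omega : 1 ≤ N)
  rw [cell_cons]
  refine abs_osc_image_sub_le (cell_nonempty hN h w) (fun a ha => hB a (hsub ha))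
    (fun a ha => hB a (hLsub a ha)) (abs_pos.1 (hS0 _ (hf.L_mem l (hsub ht)))) fun a ha b hb => ?_
  have hSl : ∀ a ∈ P.cell w, |P.S (P.L l a) - P.S (P.L l t)| ≤ K * (P.side / N ^ p) := by
    intro a ha
    have := hK.dist_le_mul _ (hf.L_mem l (hsub ha)) _ (hf.L_mem l (hsub ht))
    rw [Real.dist_eq] at this
    exact this.trans (mul_le_mul_of_nonneg_left (hd a ha t ht) K.2)
  have hql : |q (P.L l a) - q (P.L l b)| ≤ K' * (P.side / N ^ p) := by
    have := hK'.dist_le_mul _ (hf.L_mem l (hsub ha)) _ (hf.L_mem l (hsub hb))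
    rw [Real.dist_eq] at this
    exact this.trans (mul_le_mul_of_nonneg_left (hd a ha b hb) K'.2)
  have hprod : ∀ a ∈ P.cell w,
      |(P.S (P.L l a) - P.S (P.L l t)) * f a| ≤ K * (P.side / N ^ p) * B := by
    intro a ha
    rw [abs_mul]
    exact mul_le_mul (hSl a ha) (hB a (hsub ha)) (abs_nonneg _) (by positivity)
  rw [hf.apply_L hq l (hsub ha), hf.apply_L hq l (hsub hb)]
  have e : P.S (P.L l a) * f a + q (P.L l a) - (P.S (P.L l b) * f b + q (P.L l b))
      - P.S (P.L l t) * (f a - f b) = (P.S (P.L l a) - P.S (P.L l t)) * f a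
      - (P.S (P.L l b) - P.S (P.L l t)) * f b + (q (P.L l a) - q (P.L l b)) := by ring
  have e2 : (2 * B * K + K') * P.side / N ^ p = K * (P.side / N ^ p) * B
      + K * (P.side / N ^ p) * B + K' * (P.side / N ^ p) := by ring
  rw [e, e2]
  exact (abs_add_le _ _).trans (add_le_add ((abs_sub _ _).trans
    (add_le_add (hprod a ha) (hprod b hb))) hql)

variable (P f) in
/-- Oscillation sum weighted by the `j`-th iterate of the transfer operator. -/
noncomputable def weightedOscSum (p j : ℕ) : ℝ :=
  ∑ w : Fin p → Fin N × Fin N,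
    P.transfer j (P.wordMap p w (P.x 0, P.y 0)) * osc f (P.cell w)

theorem weightedOscSum_zero_right (p : ℕ) : P.weightedOscSum f p 0 = P.oscSum f p := by
  simp [weightedOscSum, oscSum, transfer]

theorem exists_weightedOscSum_shift (hN : 2 ≤ N) (h : P.IsUniform) (hf : P.IsFIF f)
    (hS : ∃ K, LipschitzOnWith K P.S P.D) {q : ℝ × ℝ → ℝ} (hq : P.IsOffset q)
    (hqLip : ∃ K, LipschitzOnWith K q P.D) (hS0 : ∀ t ∈ P.D, 0 < |P.S t|) {r C : ℝ}
    (hr0 : 0 < r) (hC : 0 < C) (hr : ∀ p, ∀ t ∈ P.D, P.transfer p t ≤ C * r ^ p) :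
    ∃ C', 0 ≤ C' ∧ ∀ p j, |P.weightedOscSum f (p + 1) j - P.weightedOscSum f p (j + 1)|
      ≤ C' * (N : ℝ) ^ p * r ^ j := by
  obtain ⟨A, hA0, hA⟩ := exists_osc_cell_cons hN h hf hS hq hqLip hS0
  -- There are N² letters and N^(2p) words, each contributing at most C r^j · A / N^p.
  refine ⟨N * N * C * A, by positivity, fun p j => ?_⟩
  have ht₀ := corner_mem_D h hN
  -- The base point of the cell of lw is L_l of that of w, so the weights match the recursion of
  -- `transfer` exactly and only the oscillation errors remain.
  have e : P.weightedOscSum f (p + 1) j - P.weightedOscSum f p (j + 1)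
      = ∑ l : Fin N × Fin N, ∑ w : Fin p → Fin N × Fin N,
        P.transfer j (P.L l (P.wordMap p w (P.x 0, P.y 0))) *
        (osc f (P.cell (Fin.cons l w : Fin (p + 1) → Fin N × Fin N))
          - |P.S (P.L l (P.wordMap p w (P.x 0, P.y 0)))| * osc f (P.cell w)) := by
    simp only [weightedOscSum, transfer, Finset.sum_mul, mul_sub, Finset.sum_sub_distrib]
    rw [sum_cons]
    simp only [wordMap_cons]
    congr 1
    rw [Finset.sum_comm]
    refine Finset.sum_congr rfl fun l _ => Finset.sum_congr rfl fun w _ => by ring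
  rw [e]
  have hN0 : (N : ℝ) ≠ 0 := by positivity
  calc _ ≤ ∑ _l : Fin N × Fin N, ∑ _w : Fin p → Fin N × Fin N, C * r ^ j * (A / N ^ p) := by
        refine (Finset.abs_sum_le_sum_abs _ _).trans (Finset.sum_le_sum fun l _ => ?_)
        refine (Finset.abs_sum_le_sum_abs _ _).trans (Finset.sum_le_sum fun w _ => ?_)
        rw [abs_mul, abs_of_nonneg (transfer_nonneg _ _)]
        exact mul_le_mul (hr j _ (hf.L_mem l (hf.wordMap_mem w ht₀)))
          (hA p l w _ ⟨_, ht₀, rfl⟩) (abs_nonneg _) (by positivity)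
    _ = _ := by
        simp only [Finset.sum_const, Finset.card_univ, Fintype.card_prod, Fintype.card_fin,
          Fintype.card_fun, nsmul_eq_mul]
        push_cast
        rw [mul_pow]
        field_simp

/-- Upper growth bound for the oscillation sums. -/
theorem exists_oscSum_le (hN : 2 ≤ N) (h : P.IsUniform) (hf : P.IsFIF f) {r C C' : ℝ}
    (hr0 : 0 < r) (hC : 0 < C) (hr : ∀ p, ∀ t ∈ P.D, P.transfer p t ≤ C * r ^ p)
    (hC' : 0 ≤ C') (hshift : ∀ p j,
      |P.weightedOscSum f (p + 1) j - P.weightedOscSum f p (j + 1)| ≤ C' * (N : ℝ) ^ p * r ^ j)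
    {s : ℝ} (hrs : r ≤ s) (hNs : (N : ℝ) < s) :
    ∃ A, 0 < A ∧ ∀ p, P.oscSum f p ≤ A * s ^ p := by
  have hs : 0 < s := hr0.trans_le hrs
  have hsN : 0 < s - N := by linarith
  have hO := oscSum_nonneg hN h hf 0
  refine ⟨C * P.oscSum f 0 + C' / (s - N) + 1, by positivity, fun p => ?_⟩
  have h1 := abs_shift_sub_le hrs hr0.le hNs (by positivity) hC' hshift 0 p 0
  simp only [zero_add, pow_zero, mul_one, weightedOscSum_zero_right] at h1
  have h2 : P.weightedOscSum f 0 p ≤ C * s ^ p * P.oscSum f 0 := by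
    rw [weightedOscSum, oscSum, Finset.mul_sum]
    refine Finset.sum_le_sum fun w _ => mul_le_mul_of_nonneg_right ?_ ?_
    · refine (hr p _ (hf.wordMap_mem w (corner_mem_D h hN))).trans ?_
      gcongr
    · obtain ⟨B, hB⟩ := hf.exists_bound
      exact osc_nonneg (cell_nonempty hN h w) fun a ha => hB a (hf.cell_subset w ha)
  have h3 := (abs_le.1 h1).2
  have h4 : C' / (s - N) * (s ^ p - N ^ p) ≤ C' / (s - N) * s ^ p := by
    gcongr
    have : (0 : ℝ) ≤ (N : ℝ) ^ p := by positivity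
    linarith
  have h5 : 0 < s ^ p := by positivity
  linarith

/-- Lower growth bound for the oscillation sums. -/
theorem exists_le_oscSum (hN : 2 ≤ N) (h : P.IsUniform) (hf : P.IsFIF f) {r C C' : ℝ}
    (hr0 : 0 < r) (hC : 0 < C) (hr : ∀ p, ∀ t ∈ P.D, r ^ p ≤ C * P.transfer p t)
    (hC' : 0 ≤ C') (hshift : ∀ p j,
      |P.weightedOscSum f (p + 1) j - P.weightedOscSum f p (j + 1)| ≤ C' * (N : ℝ) ^ p * r ^ j)
    (hNr : (N : ℝ) < r)
    (hlim : limsup (fun p : ℕ => ((P.oscSum f p / (N : ℝ) ^ p : ℝ) : EReal)) atTop = ⊤) :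
    ∃ A, 0 < A ∧ ∃ p₀, ∀ p ≥ p₀, A * r ^ p ≤ P.oscSum f p := by
  have hrN : 0 < r - N := by linarith
  -- Chosen so that, after division by C and subtraction of the accumulated error C' / (r - N) · r^k
  -- N^p, exactly r^k N^p is left.
  set M : ℝ := C * (C' / (r - N) + 1) with hM
  obtain ⟨p, hp⟩ : ∃ p, M < P.oscSum f p / (N : ℝ) ^ p := by
    have : (M : EReal) < limsup (fun p : ℕ => ((P.oscSum f p / (N : ℝ) ^ p : ℝ) : EReal)) atTop := by
      rw [hlim]; exact EReal.coe_lt_top M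
    obtain ⟨p, hp⟩ := (frequently_lt_of_lt_limsup (by isBoundedDefault) this).exists
    exact ⟨p, by exact_mod_cast hp⟩
  have hNp : (0 : ℝ) < (N : ℝ) ^ p := by positivity
  rw [lt_div_iff₀ hNp] at hp
  refine ⟨(N : ℝ) ^ p / r ^ p, by positivity, p, fun m hm => ?_⟩
  obtain ⟨k, rfl⟩ := Nat.exists_eq_add_of_le hm
  have h1 := abs_shift_sub_le le_rfl hr0.le hNr (by positivity) hC' hshift p k 0
  simp only [zero_add, pow_zero, mul_one, weightedOscSum_zero_right] at h1
  have h2 : r ^ k * P.oscSum f p ≤ C * P.weightedOscSum f p k := by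
    rw [weightedOscSum, oscSum, Finset.mul_sum, Finset.mul_sum]
    refine Finset.sum_le_sum fun w _ => ?_
    rw [← mul_assoc]
    refine mul_le_mul_of_nonneg_right (hr k _ (hf.wordMap_mem w (corner_mem_D h hN))) ?_
    obtain ⟨B, hB⟩ := hf.exists_bound
    exact osc_nonneg (cell_nonempty hN h w) fun a ha => hB a (hf.cell_subset w ha)
  have h3 := (abs_le.1 h1).1
  have h4 : C' / (r - N) * (r ^ k - N ^ k) * N ^ p ≤ C' / (r - N) * r ^ k * N ^ p := by
    gcongr
    have : (0 : ℝ) ≤ (N : ℝ) ^ k := by positivity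
    linarith
  have h5 : r ^ k * (M * N ^ p) ≤ C * P.weightedOscSum f p k :=
    (mul_le_mul_of_nonneg_left hp.le (by positivity)).trans h2
  have h6 : r ^ k * ((C' / (r - N) + 1) * N ^ p) ≤ P.weightedOscSum f p k := by
    refine le_of_mul_le_mul_left (le_of_eq_of_le ?_ h5) hC
    rw [hM]; ring
  have h7 : (N : ℝ) ^ p / r ^ p * r ^ (p + k) = r ^ k * N ^ p := by
    rw [pow_add]; field_simp
  rw [h7]
  linarith

end FISData

/-! ### Positions of the cells in the grid -/

/-- Position, in the grid of mesh `N * M`, of the image under the `i`-th folding map of the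
`a`-th interval of the grid of mesh `M`. -/
def foldIdx (i M a : ℕ) : ℕ := if Even i then i * M + a else i * M + (M - 1 - a)

/-- In both orientations division by M recovers i, and then the offset determines a. -/
theorem foldIdx_inj {i j M a b : ℕ} (ha : a < M) (hb : b < M)
    (h : foldIdx i M a = foldIdx j M b) : i = j ∧ a = b := by
  have key : ∀ i a : ℕ, a < M → foldIdx i M a / M = i := by
    intro i a ha
    unfold foldIdx
    split_ifs
    · rw [Nat.div_eq_of_lt_le] <;> nlinarith
    · rw [Nat.div_eq_of_lt_le]
      · omega
      · have : M - 1 - a < M := by omega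
        nlinarith
  have hij : i = j := by rw [← key i a ha, ← key j b hb, h]
  subst hij
  refine ⟨rfl, ?_⟩
  unfold foldIdx at h
  split_ifs at h <;> omega

theorem foldIdx_lt {i N M a : ℕ} (hi : i < N) (ha : a < M) : foldIdx i M a < N * M := by
  have : (i + 1) * M ≤ N * M := Nat.mul_le_mul_right _ hi
  unfold foldIdx
  rw [add_mul] at this
  split_ifs <;> omega

theorem foldMap_mem_Icc {N : ℕ} {x : Fin (N + 1) → ℝ} {d δ : ℝ} {M a : ℕ} (hN : 0 < N)
    (hd : 0 < d) (h : ∀ i : Fin N, x i.succ - x i.castSucc = d) (hdδ : d = M * δ) (ha : a < M)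
    (i : Fin N) {t : ℝ} (h1 : x 0 + a * (N * δ) ≤ t) (h2 : t ≤ x 0 + (a + 1) * (N * δ)) :
    x 0 + foldIdx i M a * δ ≤ foldMap x i t ∧
      foldMap x i t ≤ x 0 + (foldIdx i M a + 1) * δ := by
  have hN' : (0 : ℝ) < N := by positivity
  have e1 : a * δ ≤ (t - x 0) / N := by rw [le_div_iff₀ hN']; linarith
  have e2 : (t - x 0) / N ≤ (a + 1) * δ := by rw [div_le_iff₀ hN']; linarith
  rw [foldMap_eq_of_uniform hd hN h, hdδ, foldIdx]
  split_ifs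
  · push_cast
    constructor <;> linarith
  · have : ((M - 1 - a : ℕ) : ℝ) = M - 1 - a := by
      rw [Nat.sub_sub, Nat.cast_sub (by omega)]; push_cast; ring
    push_cast
    rw [this]
    constructor <;> linarith

/-! ### Counting cubes -/

theorem card_Icc_ceil_floor_le {u v : ℝ} (h : u ≤ v + 1) :
    ((Finset.Icc ⌈u⌉ ⌊v⌋).card : ℝ) ≤ v - u + 1 := by
  rw [Int.card_Icc]
  have h1 := Int.le_ceil u
  have h2 := Int.floor_le v
  rcases le_total (⌊v⌋ + 1 - ⌈u⌉) 0 with h0 | h0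
  · rw [Int.toNat_of_nonpos h0]; push_cast; linarith
  · have : (((⌊v⌋ + 1 - ⌈u⌉).toNat : ℤ) : ℝ) = ⌊v⌋ + 1 - ⌈u⌉ := by
      rw [Int.toNat_of_nonneg h0]; push_cast; ring
    rw [Int.cast_natCast] at this
    rw [this]; linarith

/-- The indices of the `ε`-coordinate cubes that meet `E`. -/
def cubeIndices {d : ℕ} (E : Set (Fin d → ℝ)) (ε : ℝ) : Set (Fin d → ℤ) :=
  {n | (coordCube ε n ∩ E).Nonempty}

/-- The closed interval [nε, (n+1)ε] meets [lo, hi] only if lo/ε - 1 ≤ n ≤ hi/ε; this is the source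
of the +2 in the counts. -/
theorem cubeIndices_subset_piFinset {d : ℕ} {E : Set (Fin d → ℝ)} {ε : ℝ} (hε : 0 < ε)
    {lo hi : Fin d → ℝ} (hE : ∀ p ∈ E, ∀ i, lo i ≤ p i ∧ p i ≤ hi i) :
    cubeIndices E ε ⊆ (Fintype.piFinset fun i =>
      Finset.Icc ⌈lo i / ε - 1⌉ ⌊hi i / ε⌋ : Finset (Fin d → ℤ)) := by
  rintro n ⟨p, hp, hpE⟩
  rw [Finset.mem_coe, Fintype.mem_piFinset]
  intro i
  have h1 := hp i
  have h2 := hE p hpE i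
  rw [Finset.mem_Icc, Int.ceil_le, Int.le_floor, sub_le_iff_le_add, div_le_iff₀ hε,
    le_div_iff₀ hε]
  constructor <;> linarith

theorem cubeIndices_finite {d : ℕ} {E : Set (Fin d → ℝ)} {ε : ℝ} (hε : 0 < ε)
    {lo hi : Fin d → ℝ} (hE : ∀ p ∈ E, ∀ i, lo i ≤ p i ∧ p i ≤ hi i) :
    (cubeIndices E ε).Finite :=
  (Finset.finite_toSet _).subset (cubeIndices_subset_piFinset hε hE)

theorem ncard_cubeIndices_le {d : ℕ} {E : Set (Fin d → ℝ)} {ε : ℝ} (hε : 0 < ε)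
    {lo hi : Fin d → ℝ} (hlh : ∀ i, lo i ≤ hi i) (hE : ∀ p ∈ E, ∀ i, lo i ≤ p i ∧ p i ≤ hi i) :
    ((cubeIndices E ε).ncard : ℝ) ≤ ∏ i, ((hi i - lo i) / ε + 2) := by
  have h1 := Set.ncard_le_ncard (cubeIndices_subset_piFinset hε hE) (Finset.finite_toSet _)
  rw [Set.ncard_coe_finset, Fintype.card_piFinset] at h1
  have h2 : ((cubeIndices E ε).ncard : ℝ)
      ≤ ∏ i, ((Finset.Icc ⌈lo i / ε - 1⌉ ⌊hi i / ε⌋).card : ℝ) := by exact_mod_cast h1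
  refine h2.trans ?_
  refine Finset.prod_le_prod (fun i _ => by positivity) fun i _ => ?_
  have h2 : lo i / ε ≤ hi i / ε := by gcongr; exact hlh i
  refine (card_Icc_ceil_floor_le (by linarith)).trans (le_of_eq ?_)
  ring

/-! ### Cubes over the cells of the graph -/

namespace FISData

variable {N : ℕ} {P : FISData N} {f : ℝ × ℝ → ℝ}

/-- Distinct words occupy distinct squares of the N^n × N^n grid. Injectivity is what bounds the
number of cells near a given cube, since cells themselves may share boundaries. -/
theorem exists_cell_index (hN : 2 ≤ N) (h : P.IsUniform) (n : ℕ) :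
    ∃ idx : (Fin n → Fin N × Fin N) → ℕ × ℕ, Function.Injective idx ∧
      (∀ w, (idx w).1 < N ^ n ∧ (idx w).2 < N ^ n) ∧ ∀ w, ∀ t ∈ P.cell w,
        (P.x 0 + (idx w).1 * (P.side / N ^ n) ≤ t.1 ∧
          t.1 ≤ P.x 0 + ((idx w).1 + 1) * (P.side / N ^ n)) ∧
        (P.y 0 + (idx w).2 * (P.side / N ^ n) ≤ t.2 ∧
          t.2 ≤ P.y 0 + ((idx w).2 + 1) * (P.side / N ^ n)) := by
  have hN0 : 0 < N := by omega
  have hN' : (N : ℝ) ≠ 0 := by positivity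
  induction n with
  | zero =>
    refine ⟨fun _ => (0, 0), fun a b _ => Subsingleton.elim a b, by simp, ?_⟩
    rintro w _ ⟨t, ht, rfl⟩
    simpa [wordMap] using h.mem_D_iff.1 ht
  | succ n ih =>
    obtain ⟨idx, hinj, hlt, hmem⟩ := ih
    refine ⟨fun w => (foldIdx (w 0).1 (N ^ n) (idx (Fin.tail w)).1,
      foldIdx (w 0).2 (N ^ n) (idx (Fin.tail w)).2), ?_, ?_, ?_⟩
    · intro w v hwv
      obtain ⟨e1, e2⟩ := Prod.mk.inj hwv
      obtain ⟨a1, b1⟩ := foldIdx_inj (hlt _).1 (hlt _).1 e1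
      obtain ⟨a2, b2⟩ := foldIdx_inj (hlt _).2 (hlt _).2 e2
      rw [← Fin.cons_self_tail w, ← Fin.cons_self_tail v, hinj (Prod.ext b1 b2),
        Prod.ext (Fin.ext a1) (Fin.ext a2)]
    · intro w
      rw [pow_succ, mul_comm]
      exact ⟨foldIdx_lt (w 0).1.2 (hlt _).1, foldIdx_lt (w 0).2.2 (hlt _).2⟩
    · rintro w _ ⟨t, ht, rfl⟩
      obtain ⟨h1, h2⟩ := hmem (Fin.tail w) _ ⟨t, ht, rfl⟩
      have hd : 0 < P.side / N := div_pos (side_pos hN) (by positivity)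
      have e : P.side / (N : ℝ) ^ n = N * (P.side / N ^ (n + 1)) := by
        rw [pow_succ]; field_simp
      have e' : P.side / N = (N ^ n : ℕ) * (P.side / N ^ (n + 1)) := by
        push_cast; rw [pow_succ]; field_simp
      rw [e] at h1 h2
      exact ⟨foldMap_mem_Icc hN0 hd h.x_step e' (hlt _).1 (w 0).1 h1.1 h1.2,
        foldMap_mem_Icc hN0 hd h.y_step e' (hlt _).2 (w 0).2 h2.1 h2.2⟩

variable (P f) in
/-- The part of the graph that lies over a cell. -/
def cellGraph {n : ℕ} (w : Fin n → Fin N × Fin N) : Set (Fin 3 → ℝ) :=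
  (fun t : ℝ × ℝ => ![t.1, t.2, f t]) '' P.cell w

theorem graph_finite_cubes (h : P.IsUniform) (hf : P.IsFIF f) {ε : ℝ} (hε : 0 < ε) :
    (cubeIndices (P.graph f) ε).Finite := by
  obtain ⟨B, hB⟩ := hf.exists_bound
  refine cubeIndices_finite hε (lo := ![P.x 0, P.y 0, -B])
    (hi := ![P.x 0 + P.side, P.y 0 + P.side, B]) ?_
  rintro _ ⟨t, ht, rfl⟩ i
  have h1 := h.mem_D_iff.1 ht
  have h2 := abs_le.1 (hB t ht)
  fin_cases i
  exacts [h1.1, h1.2, h2]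

theorem cellGraph_subset (hf : P.IsFIF f) {n : ℕ} (w : Fin n → Fin N × Fin N) :
    P.cellGraph f w ⊆ P.graph f := Set.image_mono (hf.cell_subset w)

theorem cubeIndices_cellGraph_subset (hf : P.IsFIF f) {n : ℕ} (w : Fin n → Fin N × Fin N)
    (ε : ℝ) : cubeIndices (P.cellGraph f w) ε ⊆ cubeIndices (P.graph f) ε :=
  fun _ hn => hn.mono (Set.inter_subset_inter_right _ (cellGraph_subset hf w))

theorem ncard_cellGraph_le (hN : 2 ≤ N) (h : P.IsUniform) (hf : P.IsFIF f) {p : ℕ} {ε : ℝ}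
    (hε : P.side / N ^ p ≤ ε) (w : Fin p → Fin N × Fin N) :
    ((cubeIndices (P.cellGraph f w) ε).ncard : ℝ) ≤ 9 * (osc f (P.cell w) / ε + 2) := by
  obtain ⟨idx, -, -, hidx⟩ := exists_cell_index hN h p
  obtain ⟨B, hB⟩ := hf.exists_bound
  have hB' : ∀ a ∈ P.cell w, |f a| ≤ B := fun a ha => hB a (hf.cell_subset w ha)
  have hδ : 0 < P.side / N ^ p := div_pos (side_pos hN) (by positivity)
  have hε0 : 0 < ε := hδ.trans_le hε
  have hne := cell_nonempty hN h w
  have hosc := osc_nonneg hne hB'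
  set δ := P.side / (N : ℝ) ^ p with hδdef
  set m := sInf (f '' P.cell w) with hm
  have hbdd : BddBelow (f '' P.cell w) := by
    refine ⟨-B, ?_⟩
    rintro _ ⟨a, ha, rfl⟩
    exact (abs_le.1 (hB' a ha)).1
  have hz : ∀ a ∈ P.cell w, m ≤ f a ∧ f a ≤ m + osc f (P.cell w) := by
    refine fun a ha => ⟨csInf_le hbdd ⟨a, ha, rfl⟩, ?_⟩
    have : f a - osc f (P.cell w) ≤ m := by
      refine le_csInf (hne.image f) ?_
      rintro _ ⟨b, hb, rfl⟩
      have := sub_le_osc hB' ha hb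
      linarith
    linarith
  have key := ncard_cubeIndices_le (E := P.cellGraph f w) hε0
    (lo := ![P.x 0 + (idx w).1 * δ, P.y 0 + (idx w).2 * δ, m])
    (hi := ![P.x 0 + ((idx w).1 + 1) * δ, P.y 0 + ((idx w).2 + 1) * δ, m + osc f (P.cell w)])
    (by
      intro i
      fin_cases i
      · simp; linarith
      · simp; linarith
      · simpa using hosc)
    (by
      rintro _ ⟨t, ht, rfl⟩ i
      have h1 := hidx w t ht
      fin_cases i
      exacts [h1.1, h1.2, hz t ht])
  refine key.trans ?_
  rw [Fin.prod_univ_three]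
  simp only [Matrix.cons_val_zero, Matrix.cons_val_one, Matrix.cons_val]
  have e : ∀ c a : ℝ, (c + (a + 1) * δ - (c + a * δ)) / ε + 2 ≤ 3 := by
    intro c a
    have : (c + (a + 1) * δ - (c + a * δ)) = δ := by ring
    rw [this]
    have : δ / ε ≤ 1 := (div_le_one hε0).2 hε
    linarith
  have e0 : ∀ c a : ℝ, 0 ≤ (c + (a + 1) * δ - (c + a * δ)) / ε + 2 := by
    intro c a
    have : (c + (a + 1) * δ - (c + a * δ)) = δ := by ring
    rw [this]
    positivity
  have e3 : (m + osc f (P.cell w) - m) / ε + 2 = osc f (P.cell w) / ε + 2 := by ring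
  rw [e3]
  refine mul_le_mul_of_nonneg_right ?_ (by positivity)
  calc _ ≤ (3 : ℝ) * 3 := mul_le_mul (e _ _) (e _ _) (e0 _ _) (by norm_num)
    _ = 9 := by norm_num

theorem card_words (n : ℕ) : (Fintype.card (Fin n → Fin N × Fin N) : ℝ) = ((N : ℝ) ^ n) ^ 2 := by
  simp only [Fintype.card_fun, Fintype.card_prod, Fintype.card_fin]
  push_cast
  rw [mul_pow, sq]

theorem cubeCount_graph_le (hN : 2 ≤ N) (h : P.IsUniform) (hf : P.IsFIF f) {p : ℕ} {ε : ℝ}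
    (hε : P.side / N ^ p ≤ ε) :
    (cubeCount (P.graph f) ε : ℝ) ≤ 9 * (P.oscSum f p / ε + 2 * ((N : ℝ) ^ p) ^ 2) := by
  have hδ : 0 < P.side / N ^ p := div_pos (side_pos hN) (by positivity)
  have hε0 : 0 < ε := hδ.trans_le hε
  have hfin := graph_finite_cubes h hf hε0
  have hsub : cubeIndices (P.graph f) ε ⊆
      ⋃ w ∈ (Finset.univ : Finset (Fin p → Fin N × Fin N)), cubeIndices (P.cellGraph f w) ε := by
    rintro n ⟨_, hn, t, ht, rfl⟩
    obtain ⟨w, hw⟩ := hf.exists_mem_cell p ht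
    exact Set.mem_iUnion₂.2 ⟨w, Finset.mem_univ w, _, hn, t, hw, rfl⟩
  have hfinU : (⋃ w ∈ (Finset.univ : Finset (Fin p → Fin N × Fin N)),
      cubeIndices (P.cellGraph f w) ε).Finite :=
    hfin.subset (Set.iUnion₂_subset fun w _ => cubeIndices_cellGraph_subset hf w ε)
  have h1 := (Set.ncard_le_ncard hsub hfinU).trans
    (Finset.set_ncard_biUnion_le Finset.univ fun w => cubeIndices (P.cellGraph f w) ε)
  calc (cubeCount (P.graph f) ε : ℝ)
      ≤ ∑ w : Fin p → Fin N × Fin N, ((cubeIndices (P.cellGraph f w) ε).ncard : ℝ) := by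
        exact_mod_cast h1
    _ ≤ ∑ w : Fin p → Fin N × Fin N, 9 * (osc f (P.cell w) / ε + 2) :=
        Finset.sum_le_sum fun w _ => ncard_cellGraph_le hN h hf hε w
    _ = _ := by
        rw [← Finset.mul_sum, Finset.sum_add_distrib, ← Finset.sum_div, oscSum, Finset.sum_const,
          Finset.card_univ, nsmul_eq_mul, card_words]
        ring

/-- The image of a cell under f is connected, so it contains [f b, f a]; the vertical sides of the
cubes cover this interval, and Lebesgue measure counts them. -/
theorem osc_le_mul_ncard_cellGraph (hN : 2 ≤ N) (h : P.IsUniform) (hf : P.IsFIF f) {p : ℕ}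
    {ε : ℝ} (hε : 0 < ε) (w : Fin p → Fin N × Fin N) :
    osc f (P.cell w) ≤ (cubeIndices (P.cellGraph f w) ε).ncard * ε := by
  have hfin : (cubeIndices (P.cellGraph f w) ε).Finite :=
    (graph_finite_cubes h hf hε).subset (cubeIndices_cellGraph_subset hf w ε)
  refine osc_le (cell_nonempty hN h w) fun a ha b hb => ?_
  have hconn : IsPreconnected (f '' P.cell w) :=
    (isPreconnected_cell hN h w).image f (hf.continuousOn.mono (hf.cell_subset w))
  have hIcc : Set.Icc (f b) (f a) ⊆ f '' P.cell w :=
    hconn.Icc_subset ⟨b, hb, rfl⟩ ⟨a, ha, rfl⟩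
  have hcov : Set.Icc (f b) (f a) ⊆
      ⋃ n ∈ hfin.toFinset, Set.Icc ((n 2 : ℝ) * ε) (((n 2 : ℝ) + 1) * ε) := by
    intro z hz
    obtain ⟨t, ht, rfl⟩ := hIcc hz
    let n : Fin 3 → ℤ := fun i => ⌊(![t.1, t.2, f t] : Fin 3 → ℝ) i / ε⌋
    have hn : ∀ i, (n i : ℝ) * ε ≤ (![t.1, t.2, f t] : Fin 3 → ℝ) i ∧
        (![t.1, t.2, f t] : Fin 3 → ℝ) i ≤ ((n i : ℝ) + 1) * ε := fun i =>
      ⟨(le_div_iff₀ hε).1 (Int.floor_le _), ((div_lt_iff₀ hε).1 (Int.lt_floor_add_one _)).le⟩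
    refine Set.mem_iUnion₂.2 ⟨n, ?_, hn 2⟩
    rw [Set.Finite.mem_toFinset]
    exact ⟨_, hn, t, ht, rfl⟩
  have hvol := (MeasureTheory.measure_mono (μ := MeasureTheory.volume) hcov).trans
    (MeasureTheory.measure_biUnion_finset_le hfin.toFinset _)
  simp only [Real.volume_Icc] at hvol
  have e : ∀ n : Fin 3 → ℤ, ((n 2 : ℝ) + 1) * ε - (n 2 : ℝ) * ε = ε := fun n => by ring
  simp only [e, Finset.sum_const, nsmul_eq_mul] at hvol
  rw [← ENNReal.ofReal_natCast, ← ENNReal.ofReal_mul (by positivity),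
    ENNReal.ofReal_le_ofReal_iff (by positivity)] at hvol
  rwa [Set.ncard_eq_toFinset_card _ hfin]

theorem one_le_ncard_cellGraph (hN : 2 ≤ N) (h : P.IsUniform) (hf : P.IsFIF f) {p : ℕ}
    {ε : ℝ} (hε : 0 < ε) (w : Fin p → Fin N × Fin N) :
    1 ≤ (cubeIndices (P.cellGraph f w) ε).ncard := by
  have hfin : (cubeIndices (P.cellGraph f w) ε).Finite :=
    (graph_finite_cubes h hf hε).subset (cubeIndices_cellGraph_subset hf w ε)
  rw [Nat.one_le_iff_ne_zero, ← Nat.pos_iff_ne_zero, Set.ncard_pos hfin]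
  obtain ⟨t, ht⟩ := cell_nonempty hN h w
  exact ⟨fun i => ⌊(![t.1, t.2, f t] : Fin 3 → ℝ) i / ε⌋, _, fun i =>
    ⟨(le_div_iff₀ hε).1 (Int.floor_le _), ((div_lt_iff₀ hε).1 (Int.lt_floor_add_one _)).le⟩,
    t, ht, rfl⟩

/-- When ε ≤ δ, a closed ε-interval meets at most ε/δ + 2 ≤ 3 closed intervals of a grid of mesh δ,
hence 3 · 3 in the plane. -/
theorem card_cells_meeting_cube_le (hN : 2 ≤ N) (h : P.IsUniform) {p : ℕ} {ε : ℝ}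
    (hε : 0 < ε) (hεδ : ε ≤ P.side / N ^ p) (n : Fin 3 → ℤ)
    (s : Finset (Fin p → Fin N × Fin N)) (hs : ∀ w ∈ s, n ∈ cubeIndices (P.cellGraph f w) ε) :
    (s.card : ℝ) ≤ 9 := by
  obtain ⟨idx, hinj, -, hidx⟩ := exists_cell_index hN h p
  set δ := P.side / (N : ℝ) ^ p
  have hδ : 0 < δ := hε.trans_le hεδ
  let I : ℝ → ℤ → Finset ℤ := fun c k =>
    Finset.Icc ⌈((k : ℝ) * ε - c) / δ - 1⌉ ⌊(((k : ℝ) + 1) * ε - c) / δ⌋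
  have hI : ∀ c k, ((I c k).card : ℝ) ≤ 3 := by
    intro c k
    have e : (((k : ℝ) + 1) * ε - c) / δ - (((k : ℝ) * ε - c) / δ - 1) = ε / δ + 1 := by ring
    have h1 : ε / δ ≤ 1 := (div_le_one hδ).2 hεδ
    have h2 : 0 < ε / δ := div_pos hε hδ
    refine (card_Icc_ceil_floor_le (by linarith)).trans ?_
    linarith
  have hmap : s.card ≤ (I (P.x 0) (n 0) ×ˢ I (P.y 0) (n 1)).card := by
    refine Finset.card_le_card_of_injOn (fun w => (((idx w).1 : ℤ), ((idx w).2 : ℤ))) ?_ ?_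
    · intro w hw
      obtain ⟨_, hn, t, ht, rfl⟩ := hs w hw
      have h1 := hidx w t ht
      have hn0 := hn 0
      have hn1 := hn 1
      simp only [Matrix.cons_val_zero, Matrix.cons_val_one] at hn0 hn1
      rw [Finset.mem_coe, Finset.mem_product, Finset.mem_Icc, Finset.mem_Icc, Int.ceil_le,
        Int.ceil_le, Int.le_floor, Int.le_floor, sub_le_iff_le_add, sub_le_iff_le_add,
        div_le_iff₀ hδ, div_le_iff₀ hδ, le_div_iff₀ hδ, le_div_iff₀ hδ]
      push_cast
      refine ⟨⟨?_, ?_⟩, ?_, ?_⟩ <;> linarith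
    · intro w _ v _ hwv
      obtain ⟨e1, e2⟩ := Prod.mk.inj hwv
      exact hinj (Prod.ext (by exact_mod_cast e1) (by exact_mod_cast e2))
  rw [Finset.card_product] at hmap
  calc (s.card : ℝ) ≤ ((I (P.x 0) (n 0)).card : ℝ) * ((I (P.y 0) (n 1)).card : ℝ) := by
        exact_mod_cast hmap
    _ ≤ 3 * 3 := mul_le_mul (hI _ _) (hI _ _) (by positivity) (by norm_num)
    _ = 9 := by norm_num

theorem sum_ncard_cellGraph_le (hN : 2 ≤ N) (h : P.IsUniform) (hf : P.IsFIF f) {p : ℕ} {ε : ℝ}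
    (hε : 0 < ε) (hεδ : ε ≤ P.side / N ^ p) :
    ∑ w : Fin p → Fin N × Fin N, ((cubeIndices (P.cellGraph f w) ε).ncard : ℝ)
      ≤ 9 * cubeCount (P.graph f) ε := by
  classical
  have hfin := graph_finite_cubes h hf hε
  have hQ : ∀ w : Fin p → Fin N × Fin N, ((cubeIndices (P.cellGraph f w) ε).ncard : ℝ)
      = ∑ n ∈ hfin.toFinset, if n ∈ cubeIndices (P.cellGraph f w) ε then 1 else 0 := by
    intro w
    have e : cubeIndices (P.cellGraph f w) ε
        = (hfin.toFinset.filter fun n => n ∈ cubeIndices (P.cellGraph f w) ε :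
          Finset (Fin 3 → ℤ)) := by
      ext n
      simp only [Finset.coe_filter, Set.Finite.mem_toFinset, Set.mem_ofPred_eq]
      exact ⟨fun hn => ⟨cubeIndices_cellGraph_subset hf w ε hn, hn⟩, fun hn => hn.2⟩
    conv_lhs => rw [e, Set.ncard_coe_finset]
    rw [Finset.sum_boole]
  simp only [hQ]
  rw [Finset.sum_comm]
  calc _ ≤ ∑ _n ∈ hfin.toFinset, (9 : ℝ) := by
        refine Finset.sum_le_sum fun n _ => ?_
        rw [Finset.sum_boole]
        exact card_cells_meeting_cube_le (f := f) hN h hε hεδ n _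
          fun w hw => (Finset.mem_filter.1 hw).2
    _ = 9 * cubeCount (P.graph f) ε := by
        rw [Finset.sum_const, nsmul_eq_mul, ← Set.ncard_eq_toFinset_card _ hfin, mul_comm]
        rfl

theorem oscSum_le_cubeCount (hN : 2 ≤ N) (h : P.IsUniform) (hf : P.IsFIF f) {p : ℕ} {ε : ℝ}
    (hε : 0 < ε) (hεδ : ε ≤ P.side / N ^ p) :
    P.oscSum f p / ε ≤ 9 * cubeCount (P.graph f) ε := by
  refine le_trans ?_ (sum_ncard_cellGraph_le hN h hf hε hεδ)
  rw [oscSum, Finset.sum_div]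
  refine Finset.sum_le_sum fun w _ => ?_
  rw [div_le_iff₀ hε]
  exact osc_le_mul_ncard_cellGraph hN h hf hε w

theorem pow_sq_le_cubeCount (hN : 2 ≤ N) (h : P.IsUniform) (hf : P.IsFIF f) {p : ℕ} {ε : ℝ}
    (hε : 0 < ε) (hεδ : ε ≤ P.side / N ^ p) :
    ((N : ℝ) ^ p) ^ 2 ≤ 9 * cubeCount (P.graph f) ε := by
  refine le_trans ?_ (sum_ncard_cellGraph_le hN h hf hε hεδ)
  rw [← card_words, ← Finset.card_univ, Finset.cast_card]
  exact Finset.sum_le_sum fun w _ => by exact_mod_cast one_le_ncard_cellGraph hN h hf hε w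

end FISData

/-! ### Box dimension from power bounds on the number of cubes -/

theorem hasBoxDim_of_tendsto {d : ℕ} {E : Set (Fin d → ℝ)} {s : ℝ}
    (h : Tendsto (fun ε : ℝ => Real.log (cubeCount E ε) / Real.log (1 / ε)) (𝓝[>] 0) (𝓝 s)) :
    HasBoxDim E s := by
  have h' : Tendsto (fun ε : ℝ => ((Real.log (cubeCount E ε) / Real.log (1 / ε) : ℝ) : EReal))
      (𝓝[>] 0) (𝓝 (s : EReal)) := (continuous_coe_real_ereal.tendsto s).comp h
  exact ⟨h'.liminf_eq, h'.limsup_eq⟩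

theorem tendsto_log_one_div : Tendsto (fun ε : ℝ => Real.log (1 / ε)) (𝓝[>] 0) atTop := by
  simp only [one_div]
  exact Real.tendsto_log_atTop.comp tendsto_inv_nhdsGT_zero

/-- The upper bound may lose η because oscillation sums are bounded by s^p only for s > N, which
leaves a gap when r ≤ N. -/
theorem hasBoxDim_of_rpow_bounds {d : ℕ} {E : Set (Fin d → ℝ)} {s : ℝ}
    (hlow : ∃ c > 0, ∀ᶠ ε : ℝ in 𝓝[>] 0, c * ε ^ (-s) ≤ cubeCount E ε)
    (hup : ∀ η > 0, ∃ C > 0, ∀ᶠ ε : ℝ in 𝓝[>] 0, cubeCount E ε ≤ C * ε ^ (-(s + η))) :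
    HasBoxDim E s := by
  refine hasBoxDim_of_tendsto (tendsto_order.2 ⟨fun a ha => ?_, fun a ha => ?_⟩)
  · obtain ⟨c, hc, h⟩ := hlow
    have hz : Tendsto (fun ε : ℝ => s + Real.log c / Real.log (1 / ε)) (𝓝[>] 0) (𝓝 (s + 0)) :=
      tendsto_const_nhds.add (tendsto_const_nhds.div_atTop tendsto_log_one_div)
    rw [add_zero] at hz
    filter_upwards [h, hz.eventually_const_lt ha, self_mem_nhdsWithin,
      tendsto_log_one_div.eventually_gt_atTop 0] with ε h1 h2 h3 h4
    have h3 : 0 < ε := h3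
    refine h2.trans_le ?_
    have h5 := Real.log_le_log (mul_pos hc (Real.rpow_pos_of_pos h3 _)) h1
    rw [Real.log_mul hc.ne' (Real.rpow_pos_of_pos h3 _).ne', Real.log_rpow h3] at h5
    rw [le_div_iff₀ h4, add_mul, div_mul_cancel₀ _ h4.ne', one_div, Real.log_inv]
    linarith
  · obtain ⟨c, hc, h⟩ := hlow
    obtain ⟨C, hC, h'⟩ := hup ((a - s) / 2) (by linarith)
    have hz : Tendsto (fun ε : ℝ => (s + (a - s) / 2) + Real.log C / Real.log (1 / ε)) (𝓝[>] 0)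
        (𝓝 ((s + (a - s) / 2) + 0)) :=
      tendsto_const_nhds.add (tendsto_const_nhds.div_atTop tendsto_log_one_div)
    filter_upwards [h, h', hz.eventually_lt_const (by linarith : s + (a - s) / 2 + 0 < a),
      self_mem_nhdsWithin, tendsto_log_one_div.eventually_gt_atTop 0] with ε h0 h1 h2 h3 h4
    have h3 : 0 < ε := h3
    refine lt_of_le_of_lt ?_ h2
    have hpos := (mul_pos hc (Real.rpow_pos_of_pos h3 _)).trans_le h0
    have h5 := Real.log_le_log hpos h1
    rw [Real.log_mul hC.ne' (Real.rpow_pos_of_pos h3 _).ne', Real.log_rpow h3] at h5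
    rw [div_le_iff₀ h4, add_mul, div_mul_cancel₀ _ h4.ne', one_div, Real.log_inv]
    linarith

/-! ### From oscillation sums to cube counts at every scale -/

namespace FISData

variable {N : ℕ} {P : FISData N} {f : ℝ × ℝ → ℝ}

/-- Sandwiches ε between consecutive cell sizes: upper counts use level m + 1, where cells are no
larger than ε, and lower counts use level m. -/
theorem eventually_exists_level (hN : 2 ≤ N) (p₀ : ℕ) : ∀ᶠ ε : ℝ in 𝓝[>] 0,
    0 < ε ∧ ε < 1 ∧ ∃ m ≥ p₀, ε ≤ P.side / N ^ m ∧ P.side / N ^ (m + 1) ≤ ε := by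
  have hside := side_pos (P := P) hN
  have hN1 : (1 : ℝ) < N := by exact_mod_cast (by omega : 1 < N)
  have hpos : 0 < P.side / (N : ℝ) ^ p₀ := by positivity
  filter_upwards [Ioo_mem_nhdsGT one_pos, Ioo_mem_nhdsGT hpos] with ε h1 h2
  have hε := h1.1
  have h3 : (N : ℝ) ^ p₀ ≤ P.side / ε := by
    rw [le_div_iff₀ hε, mul_comm, ← le_div_iff₀ (by positivity)]; exact h2.2.le
  obtain ⟨m, hm1, hm2⟩ := exists_nat_pow_near ((one_le_pow₀ hN1.le).trans h3) hN1
  refine ⟨hε, h1.2, m, ?_, ?_, ?_⟩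
  · have := (pow_lt_pow_iff_right₀ hN1).1 (h3.trans_lt hm2)
    omega
  · rwa [le_div_iff₀ (by positivity), mul_comm, ← le_div_iff₀ hε]
  · rw [div_le_iff₀ (by positivity), mul_comm, ← div_le_iff₀ hε]; exact hm2.le

theorem pow_rpow_eq (σ : ℝ) (p : ℕ) : ((N : ℝ) ^ σ) ^ p = ((N : ℝ) ^ p) ^ σ := by
  rw [← Real.rpow_natCast, ← Real.rpow_natCast, ← Real.rpow_mul (by positivity),
    ← Real.rpow_mul (by positivity), mul_comm]

theorem rpow_neg_one_add {ε : ℝ} (hε : 0 < ε) (σ : ℝ) : ε ^ (-(1 + σ)) = (ε ^ σ)⁻¹ / ε := by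
  rw [neg_add_rev, ← sub_eq_add_neg, Real.rpow_sub hε, Real.rpow_neg hε.le, Real.rpow_one]

theorem exists_cubeCount_le (hN : 2 ≤ N) (h : P.IsUniform) (hf : P.IsFIF f) {A σ : ℝ}
    (hA : 0 < A) (hσ : 1 ≤ σ) (hO : ∀ᶠ p in atTop, P.oscSum f p ≤ A * ((N : ℝ) ^ σ) ^ p) :
    ∃ C > 0, ∀ᶠ ε : ℝ in 𝓝[>] 0, cubeCount (P.graph f) ε ≤ C * ε ^ (-(1 + σ)) := by
  have hside := side_pos (P := P) hN
  have hN0 : (0 : ℝ) < N := by positivity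
  set b : ℝ := N * P.side with hb
  have hb0 : 0 < b := by positivity
  obtain ⟨p₀, hp₀⟩ := eventually_atTop.1 hO
  refine ⟨9 * (A * b ^ σ + 2 * b ^ 2), by positivity, ?_⟩
  filter_upwards [eventually_exists_level (P := P) hN p₀] with ε ⟨hε, hε1, m, hm, hm1, hm2⟩
  refine (cubeCount_graph_le hN h hf hm2).trans ?_
  have hpow : (N : ℝ) ^ (m + 1) ≤ b / ε := by
    rw [le_div_iff₀ hε, pow_succ]
    rw [le_div_iff₀ (by positivity)] at hm1
    rw [hb]; nlinarith
  have h1 : P.oscSum f (m + 1) / ε ≤ A * b ^ σ * ε ^ (-(1 + σ)) := by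
    rw [rpow_neg_one_add hε, ← mul_div_assoc]
    refine div_le_div_of_nonneg_right ((hp₀ (m + 1) (by omega)).trans ?_) hε.le
    rw [pow_rpow_eq, mul_assoc]
    refine mul_le_mul_of_nonneg_left ?_ hA.le
    refine (Real.rpow_le_rpow (by positivity) hpow (by linarith)).trans (le_of_eq ?_)
    rw [Real.div_rpow hb0.le hε.le, div_eq_mul_inv]
  -- Here σ ≥ 1 and ε < 1 let the cell-counting term ε^-2 be absorbed.
  have h2 : ((N : ℝ) ^ (m + 1)) ^ 2 ≤ b ^ 2 * ε ^ (-(1 + σ)) := by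
    refine (pow_le_pow_left₀ (by positivity) hpow 2).trans ?_
    rw [div_pow, div_eq_mul_inv]
    refine mul_le_mul_of_nonneg_left ?_ (by positivity)
    rw [← Real.rpow_natCast, ← Real.rpow_neg hε.le]
    exact Real.rpow_le_rpow_of_exponent_ge hε hε1.le (by push_cast; linarith)
  linarith

theorem exists_le_cubeCount (hN : 2 ≤ N) (h : P.IsUniform) (hf : P.IsFIF f) {A σ : ℝ}
    (hA : 0 < A) (hσ : 0 ≤ σ) (hO : ∀ᶠ p in atTop, A * ((N : ℝ) ^ σ) ^ p ≤ P.oscSum f p) :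
    ∃ c > 0, ∀ᶠ ε : ℝ in 𝓝[>] 0, c * ε ^ (-(1 + σ)) ≤ cubeCount (P.graph f) ε := by
  have hside := side_pos (P := P) hN
  have hN0 : (0 : ℝ) < N := by positivity
  set b : ℝ := P.side / N with hb
  have hb0 : 0 < b := by positivity
  obtain ⟨p₀, hp₀⟩ := eventually_atTop.1 hO
  refine ⟨A * b ^ σ / 9, by positivity, ?_⟩
  filter_upwards [eventually_exists_level (P := P) hN p₀] with ε ⟨hε, hε1, m, hm, hm1, hm2⟩
  have h0 := oscSum_le_cubeCount hN h hf hε hm1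
  have hpow : b / ε ≤ (N : ℝ) ^ m := by
    rw [pow_succ, div_le_iff₀ (by positivity)] at hm2
    rw [hb, div_div, div_le_iff₀ (by positivity)]; linarith
  have h1 : A * b ^ σ * ε ^ (-(1 + σ)) ≤ P.oscSum f m / ε := by
    rw [rpow_neg_one_add hε, ← mul_div_assoc]
    refine div_le_div_of_nonneg_right (le_trans ?_ (hp₀ m hm)) hε.le
    rw [pow_rpow_eq, mul_assoc]
    refine mul_le_mul_of_nonneg_left ?_ hA.le
    refine le_of_eq_of_le ?_ (Real.rpow_le_rpow (by positivity) hpow hσ)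
    rw [Real.div_rpow hb0.le hε.le, div_eq_mul_inv]
  linarith

theorem exists_rpow_neg_two_le_cubeCount (hN : 2 ≤ N) (h : P.IsUniform) (hf : P.IsFIF f) :
    ∃ c > 0, ∀ᶠ ε : ℝ in 𝓝[>] 0, c * ε ^ (-2 : ℝ) ≤ cubeCount (P.graph f) ε := by
  have hside := side_pos (P := P) hN
  have hN0 : (0 : ℝ) < N := by positivity
  set b : ℝ := P.side / N with hb
  have hb0 : 0 < b := by positivity
  refine ⟨b ^ 2 / 9, by positivity, ?_⟩
  filter_upwards [eventually_exists_level (P := P) hN 0] with ε ⟨hε, hε1, m, hm, hm1, hm2⟩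
  have h0 := pow_sq_le_cubeCount hN h hf hε hm1
  have hpow : b / ε ≤ (N : ℝ) ^ m := by
    rw [pow_succ, div_le_iff₀ (by positivity)] at hm2
    rw [hb, div_div, div_le_iff₀ (by positivity)]; linarith
  have h1 := pow_le_pow_left₀ (by positivity) hpow 2
  have h2 : (b / ε) ^ 2 = b ^ 2 * ε ^ (-2 : ℝ) := by
    rw [Real.rpow_neg hε.le, div_pow, div_eq_mul_inv]; norm_cast
  linarith

end FISData

/-! ### Assembling the dimension formula -/

theorem mainTheorem1 (N : ℕ) (hN : 2 ≤ N) (P : FISData N) (hunif : P.IsUniform)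
    (hS : ∃ K, LipschitzOnWith K P.S P.D)
    (q : ℝ × ℝ → ℝ) (hq : P.IsOffset q) (hqLip : ∃ K, LipschitzOnWith K q P.D)
    (hsign : (∀ t ∈ P.D, 0 < P.S t) ∨ (∀ t ∈ P.D, P.S t < 0))
    (f : ℝ × ℝ → ℝ) (hf : P.IsFIF f) :
    ∃ ρS : ℝ,
      Tendsto (fun n => specRad (P.upM n)) atTop (𝓝 ρS) ∧
      Tendsto (fun n => specRad (P.lowM n)) atTop (𝓝 ρS) ∧
      (((N : ℝ) < ρS ∧
          limsup (fun p : ℕ => ((P.oscSum f p / (N : ℝ) ^ p : ℝ) : EReal)) atTop = ⊤) →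
        HasBoxDim (P.graph f) (1 + Real.log ρS / Real.log N)) ∧
      (¬ ((N : ℝ) < ρS ∧
          limsup (fun p : ℕ => ((P.oscSum f p / (N : ℝ) ^ p : ℝ) : EReal)) atTop = ⊤) →
        HasBoxDim (P.graph f) 2) := by
  obtain ⟨κ, hκ⟩ := FISData.exists_logLip hS hsign
  obtain ⟨r, C, hr0, hC, hr⟩ := FISData.exists_transfer_growth hN hunif hf hκ
  obtain ⟨hup, hlow⟩ := FISData.tendsto_specRad_upM_lowM hN hunif hf hκ hr0 hC hr
  obtain ⟨C', hC', hshift⟩ := FISData.exists_weightedOscSum_shift hN hunif hf hS hq hqLip hκ.2.1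
    hr0 hC fun p t ht => (hr p t ht).2
  have hN1 : (1 : ℝ) < N := by exact_mod_cast (by omega : 1 < N)
  have hlogN : 0 < Real.log N := Real.log_pos hN1
  -- Apply the growth bound with s = N^(σ+η), which exceeds N strictly; σ is log r / log N in the
  -- first case and 1 when r ≤ N.
  have hupper : ∀ σ : ℝ, 1 ≤ σ → r ≤ (N : ℝ) ^ σ → ∀ η > 0, ∃ B > 0, ∀ᶠ ε : ℝ in 𝓝[>] 0,
      cubeCount (P.graph f) ε ≤ B * ε ^ (-((1 + σ) + η)) := by
    intro σ hσ hrσ η hη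
    have h1 : (N : ℝ) ^ σ < (N : ℝ) ^ (σ + η) := Real.rpow_lt_rpow_of_exponent_lt hN1 (by linarith)
    have h2 : (N : ℝ) ≤ (N : ℝ) ^ σ := by
      simpa using Real.rpow_le_rpow_of_exponent_le hN1.le hσ
    obtain ⟨A, hA, hO⟩ := FISData.exists_oscSum_le hN hunif hf hr0 hC
      (fun p t ht => (hr p t ht).2) hC' hshift (hrσ.trans h1.le) (h2.trans_lt h1)
    rw [add_assoc]
    exact FISData.exists_cubeCount_le hN hunif hf hA (by linarith) (Eventually.of_forall hO)
  refine ⟨r, hup, hlow, fun ⟨hNr, hlim⟩ => ?_, fun hnot => ?_⟩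
  · have hσ : (N : ℝ) ^ (Real.log r / Real.log N) = r := by
      rw [Real.rpow_def_of_pos (by linarith), mul_div_cancel₀ _ hlogN.ne', Real.exp_log hr0]
    have hσ1 : 1 ≤ Real.log r / Real.log N := by
      rw [one_le_div hlogN]
      exact Real.log_le_log (by linarith) hNr.le
    obtain ⟨A, hA, p₀, hO⟩ := FISData.exists_le_oscSum hN hunif hf hr0 hC
      (fun p t ht => (hr p t ht).1) hC' hshift hNr hlim
    refine hasBoxDim_of_rpow_bounds ?_ (hupper _ hσ1 hσ.ge)
    refine FISData.exists_le_cubeCount hN hunif hf hA (by linarith) ?_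
    rw [hσ]
    exact eventually_atTop.2 ⟨p₀, hO⟩
  · refine hasBoxDim_of_rpow_bounds (FISData.exists_rpow_neg_two_le_cubeCount hN hunif hf)
      fun η hη => ?_
    -- If r > N the growth bound is too weak, but the limsup is then finite and O_p = O(N^p)
    -- eventually.
    rcases le_or_gt r N with hrN | hrN
    · have := hupper 1 le_rfl (by simpa using hrN) η hη
      rwa [one_add_one_eq_two] at this
    · have hlt : limsup (fun p : ℕ => ((P.oscSum f p / (N : ℝ) ^ p : ℝ) : EReal)) atTop < ⊤ :=
        lt_top_iff_ne_top.2 fun h => hnot ⟨hrN, h⟩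
      obtain ⟨M, hM, -⟩ := EReal.lt_iff_exists_real_btwn.1 hlt
      have hO : ∀ᶠ p in atTop, P.oscSum f p ≤ (|M| + 1) * ((N : ℝ) ^ (1 + η)) ^ p := by
        filter_upwards [eventually_lt_of_limsup_lt hM] with p hp
        have hp' : P.oscSum f p / (N : ℝ) ^ p < M := by exact_mod_cast hp
        rw [div_lt_iff₀ (by positivity)] at hp'
        refine hp'.le.trans (mul_le_mul ?_ ?_ (by positivity) (by positivity))
        · linarith [le_abs_self M]
        · refine pow_le_pow_left₀ (by positivity) ?_ p
          simpa using Real.rpow_le_rpow_of_exponent_le hN1.le (by linarith : (1 : ℝ) ≤ 1 + η)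
      have := FISData.exists_cubeCount_le hN hunif hf (by positivity) (by linarith) hO
      rwa [← add_assoc, one_add_one_eq_two] at this
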